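/- **Proposition 1 (Asymptotic consistency).** Let $T\ge 0$, let $X$ be a Polish space, and let a base Markov chain be given by a prior law $p(x_T)$ and transition kernels $p_\theta(x_{t-1}\mid x_t)$, $t=T,\dots,1$, on $X$; write $p_\theta(x_0)$ for the marginal law of $x_0$. Let $r:X\to\mathbb R$ be measurable and bounded, $\lambda>0$, $C>0$ and $\alpha\in(0,1)$. Diffusion Tree Sampling (DTS) grows a random tree. It starts with a root, a dummy node at time $T+1$ whose proposal $p_\theta(\cdot\mid x_{T+1})$ is the prior. Each node $x_t$ carries a visit count $N(x_t)$, equal to $1$ at creation, a finite family $\mathcal C(x_t)$ of children and a value estimate $\hat v(x_t)$. One tree iteration starts at the root and does the following. *Selection:* at a node $x_t$ with $t>0$ and $|\mathcal C(x_t)|\ge C\,N(x_t)^\alpha$, move to a child $x_{t-1}\in\mathcal C(x_t)$ chosen with probability proportional to $\exp(\lambda\hat v(x_{t-1}))$. *Expansion and rollout:* at the first node $x_t$ with $t>0$ and $|\mathcal C(x_t)|<C\,N(x_t)^\alpha$, add a new child $x_{t-1}\sim p_\theta(\cdot\mid x_t)$ and continue by sampling $x_{t'-1}\sim p_\theta(\cdot\mid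 x_{t'})$ down to $x_0$; all these states become nodes of the tree. *Backup:* set $\hat v(x_0)=r(x_0)$ and, along the path from the terminal node $x_0$ reached in this iteration up to the root, replace $\hat v(x_{t+1})$ by $$\frac1\lambda\log\Big(\frac1{|\mathcal C(x_{t+1})|}\sum_{x_t\in\mathcal C(x_{t+1})}\exp(\lambda\hat v(x_t))\Big)$$ and increase $N(x_{t+1})$ by $1$. Let $\pi^*$ be the probability measure on $X$ with $\pi^*(dx)\propto \exp(\lambda r(x))\,p_\theta(dx)$, where $p_\theta$ is the marginal law of $x_0$. Then, almost surely, as the number $M$ of tree iterations tends to infinity, 1. the empirical distribution $\frac1M\sum_{m=1}^M\delta_{x_0^{(m)}}$ of the terminal states $x_0^{(1)},x_0^{(2)},\dots$ reached in the successive iterations converges weakly to $\pi^*$; 2. the law, given the tree built in the first $M$ iterations, of a terminal state sampled from that tree by selection steps alone (Boltzmann choice of a child at every node from the root to a terminal node) converges weakly to $\pi^*$. -/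

import Mathlib

open MeasureTheory ProbabilityTheory Filter Topology

noncomputable section

namespace DTS

/-- A node of the search tree: its visit count `N` and number of children `n` (the index `(N, n)`),
its state in `S`, and the subtrees hanging from it, listed in order of creation. -/
abbrev Node (S A : Type*) : Type _ := Σ k : ℕ × ℕ, S × (Fin k.2 → A)

section Node

variable {S A X : Type*}

/-- The visit count `N` of a node. -/
def Node.visits (ν : Node S A) : ℕ := ν.1.1

/-- The number of children of a node. -/
def Node.numChildren (ν : Node S A) : ℕ := ν.1.2

/-- The state stored at a node. -/
def Node.state (ν : Node S A) : S := ν.2.1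

/-- The subtree at the `i`-th child of a node. -/
def Node.child (ν : Node S A) (i : Fin ν.numChildren) : A := ν.2.2 i

/-- A newly created node: `N = 1`, no children. -/
def Node.new (s : S) : Node S A := ⟨(1, 0), (s, fun i => i.elim0)⟩

/-- The node after expansion: the subtree `a` is appended to the children, `N` is incremented. -/
def Node.addChild (ν : Node S A) (a : A) : Node S A :=
  ⟨(ν.visits + 1, ν.numChildren + 1), (ν.state, Fin.snoc (α := fun _ => A) ν.child a)⟩

/-- The node after its `i`-th child was visited: that subtree becomes `a`, `N` is incremented. -/
def Node.setChild (ν : Node S A) (i : Fin ν.numChildren) (a : A) : Node S A :=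
  ⟨(ν.visits + 1, ν.numChildren), (ν.state, Function.update ν.child i a)⟩

/-- Progressive widening: a node is expanded when it has no child, or fewer than `C * N ^ α`.
(If `C > 0` the first alternative is a case of the second, as `N ≥ 1`.) -/
def Node.Expandable (C α : ℝ) (ν : Node S A) : Prop :=
  ν.numChildren = 0 ∨ (ν.numChildren : ℝ) < C * (ν.visits : ℝ) ^ α

/-- Soft Bellman backup, the expectation over the proposal being estimated by the average over the
children: `(1 / lam) * log ((1 / n) * ∑ i, exp (lam * v i))`. -/
def Node.backup (lam : ℝ) (v : A → ℝ) (ν : Node S A) : ℝ :=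
  1 / lam * Real.log (1 / (ν.numChildren : ℝ) * ∑ i, Real.exp (lam * v (ν.child i)))

/-- Boltzmann probability of selecting the `i`-th child. -/
def Node.boltzmann (lam : ℝ) (v : A → ℝ) (ν : Node S A) (i : Fin ν.numChildren) : ℝ :=
  Real.exp (lam * v (ν.child i)) / ∑ j, Real.exp (lam * v (ν.child j))

variable [MeasurableSpace S] [MeasurableSpace A] [MeasurableSpace X]

open Classical in
/-- One tree iteration started at a node `ν`: the joint law of the updated node and of the terminal
state that is reached. `proposal` samples the state of a new child, `init` makes it a new node,
`v` is the current value estimate of a child and `visit` is the same iteration one level below.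
In the expansion case the new node has no children, so `visit` performs a rollout from it. -/
def visitMeasure (lam C α : ℝ) (proposal : Kernel S X) (init : X → A) (v : A → ℝ)
    (visit : Kernel A (A × X)) (ν : Node S A) : Measure (Node S A × X) :=
  if ν.Expandable C α then
    ((proposal ν.state).bind fun x => visit (init x)).map fun y => (ν.addChild y.1, y.2)
  else
    ∑ i, ENNReal.ofReal (ν.boltzmann lam v i) •
      (visit (ν.child i)).map fun y => (ν.setChild i y.1, y.2)

theorem measurable_of_node {Y : Type*} [MeasurableSpace Y] {f : Node S A → Y}
    (h : ∀ k : ℕ × ℕ, Measurable fun p : S × (Fin k.2 → A) => f ⟨k, p⟩) : Measurable f := by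
  intro s hs
  refine MeasurableSpace.measurableSet_iInf.2 fun k => ?_
  exact h k hs

theorem measurable_node_mk (k : ℕ × ℕ) :
    Measurable fun p : S × (Fin k.2 → A) => (⟨k, p⟩ : Node S A) := by
  intro s hs
  exact MeasurableSpace.measurableSet_iInf.1 hs k

theorem measurable_backup (lam : ℝ) {v : A → ℝ} (hv : Measurable v) :
    Measurable fun ν : Node S A => ν.backup lam v := by
  refine measurable_of_node fun k => ?_
  have h : Measurable fun p : S × (Fin k.2 → A) => ∑ i, Real.exp (lam * v (p.2 i)) :=
    Finset.measurable_sum _ fun i _ => by fun_prop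
  exact (Real.measurable_log.comp (h.const_mul (1 / (k.2 : ℝ)))).const_mul (1 / lam)

theorem measurable_new : Measurable fun s : S => (Node.new s : Node S A) :=
  (measurable_node_mk (1, 0)).comp (by fun_prop)

theorem measurable_snoc (n : ℕ) :
    Measurable fun p : (Fin n → A) × A => (Fin.snoc (α := fun _ => A) p.1 p.2 : Fin (n + 1) → A) := by
  refine measurable_pi_lambda _ fun i => ?_
  refine Fin.lastCases ?_ (fun j => ?_) i
  · simpa using measurable_snd
  · simpa [Function.comp_def] using (measurable_pi_apply j).comp measurable_fst

/-- A parametrised push-forward of a Markov kernel is measurable. -/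
theorem measurable_map_param {P Y Z : Type*} [MeasurableSpace P] [MeasurableSpace Y]
    [MeasurableSpace Z] (κ : Kernel P Y) [IsMarkovKernel κ] {g : P → Y → Z}
    (hg : Measurable fun q : P × Y => g q.1 q.2) : Measurable fun p => (κ p).map (g p) := by
  have h := ((Kernel.id ×ₖ κ).map fun q : P × Y => g q.1 q.2).measurable
  convert h using 2 with p
  rw [Kernel.map_apply _ hg, Kernel.prod_apply, Kernel.id_apply, Measure.dirac_prod,
    Measure.map_map hg measurable_prodMk_left]
  rfl

theorem measurable_visitMeasure (lam C α : ℝ) (proposal : Kernel S X) [IsMarkovKernel proposal]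
    {init : X → A} (hi : Measurable init) {v : A → ℝ} (hv : Measurable v)
    (visit : Kernel A (A × X)) [IsMarkovKernel visit] :
    Measurable (visitMeasure lam C α proposal init v visit) := by
  refine measurable_of_node fun k => ?_
  by_cases hk : k.2 = 0 ∨ (k.2 : ℝ) < C * (k.1 : ℝ) ^ α
  · have h : ∀ p : S × (Fin k.2 → A), Node.Expandable C α (⟨k, p⟩ : Node S A) := fun _ => hk
    simp only [visitMeasure, h, if_true]
    have := measurable_map_param
      (((visit.comap init hi) ∘ₖ proposal).comap (Prod.fst : S × (Fin k.2 → A) → S) measurable_fst)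
      (g := fun p y => (Node.addChild (⟨k, p⟩ : Node S A) y.1, y.2)) (by
        refine Measurable.prodMk ?_ (by fun_prop)
        refine (measurable_node_mk (k.1 + 1, k.2 + 1)).comp ?_
        refine Measurable.prodMk (measurable_fst.comp measurable_fst) ?_
        exact (measurable_snoc k.2).comp (f := fun q : (S × (Fin k.2 → A)) × A × X =>
          (q.1.2, q.2.1)) (by fun_prop))
    exact this
  · have h : ∀ p : S × (Fin k.2 → A), ¬ Node.Expandable C α (⟨k, p⟩ : Node S A) := fun _ => hk
    simp only [visitMeasure, h, if_false]
    refine Measure.measurable_of_measurable_coe _ fun s hs => ?_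
    simp only [Measure.finsetSum_apply, Measure.smul_apply, smul_eq_mul]
    change Measurable fun p : S × (Fin k.2 → A) => ∑ i : Fin k.2,
      ENNReal.ofReal (Node.boltzmann lam v (⟨k, p⟩ : Node S A) i) *
        ((visit (p.2 i)).map fun y => (Node.setChild (⟨k, p⟩ : Node S A) i y.1, y.2)) s
    refine Finset.measurable_sum _ fun i _ => ?_
    refine Measurable.mul ?_ ?_
    · have h : Measurable fun p : S × (Fin k.2 → A) => ∑ i, Real.exp (lam * v (p.2 i)) :=
        Finset.measurable_sum _ fun i _ => by fun_prop
      have h' : Measurable fun p : S × (Fin k.2 → A) => Real.exp (lam * v (p.2 i)) :=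
        Real.measurable_exp.comp ((hv.comp ((measurable_pi_apply _).comp measurable_snd)).const_mul _)
      exact (h'.div h).ennreal_ofReal
    · refine (Measure.measurable_coe hs).comp ?_
      exact measurable_map_param
        (visit.comap (fun p : S × (Fin k.2 → A) => p.2 i) (by fun_prop))
        (g := fun p y => (Node.setChild (⟨k, p⟩ : Node S A) i y.1, y.2)) (by
          refine Measurable.prodMk ?_ (by fun_prop)
          refine (measurable_node_mk (k.1 + 1, k.2)).comp ?_
          refine Measurable.prodMk (measurable_fst.comp measurable_fst) ?_
          exact (measurable_update' (X := fun _ : Fin k.2 => A) (a := i)).comp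
            (f := fun q : (S × (Fin k.2 → A)) × A × X => (q.1.2, q.2.1)) (by fun_prop))

theorem isProbabilityMeasure_visitMeasure (lam C α : ℝ) (proposal : Kernel S X)
    [IsMarkovKernel proposal] {init : X → A} (hi : Measurable init) (v : A → ℝ)
    (visit : Kernel A (A × X)) [IsMarkovKernel visit] (ν : Node S A) :
    IsProbabilityMeasure (visitMeasure lam C α proposal init v visit ν) := by
  unfold visitMeasure
  split_ifs with h
  · have : IsProbabilityMeasure ((proposal ν.state).bind fun x => visit (init x)) :=
      inferInstanceAs (IsProbabilityMeasure (((visit.comap init hi) ∘ₖ proposal) ν.state))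
    refine Measure.isProbabilityMeasure_map (Measurable.aemeasurable ?_)
    refine Measurable.prodMk ((measurable_node_mk _).comp ?_) measurable_snd
    refine Measurable.prodMk measurable_const ?_
    exact (measurable_snoc ν.numChildren).comp (f := fun y : A × X => (ν.child, y.1)) (by fun_prop)
  · have hn : ν.numChildren ≠ 0 := fun h' => h (Or.inl h')
    have hm : ∀ i, IsProbabilityMeasure
        ((visit (ν.child i)).map fun y => (ν.setChild i y.1, y.2)) := fun i => by
      refine Measure.isProbabilityMeasure_map (Measurable.aemeasurable ?_)
      refine Measurable.prodMk ((measurable_node_mk _).comp ?_) measurable_snd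
      refine Measurable.prodMk measurable_const ?_
      exact (measurable_update ν.child).comp measurable_fst
    have : Nonempty (Fin ν.numChildren) := ⟨⟨0, Nat.pos_of_ne_zero hn⟩⟩
    have hpos : 0 < ∑ j, Real.exp (lam * v (ν.child j)) :=
      Finset.sum_pos (fun j _ => Real.exp_pos _) Finset.univ_nonempty
    constructor
    simp only [Measure.finsetSum_apply, Measure.smul_apply, smul_eq_mul, measure_univ, mul_one]
    rw [← ENNReal.ofReal_sum_of_nonneg fun i _ => by unfold Node.boltzmann; positivity]
    simp only [Node.boltzmann, ← Finset.sum_div]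
    rw [div_self hpos.ne', ENNReal.ofReal_one]

/-- `visitMeasure` as a kernel. -/
def visitKernel (lam C α : ℝ) (proposal : Kernel S X) [IsMarkovKernel proposal]
    {init : X → A} (hi : Measurable init) {v : A → ℝ} (hv : Measurable v)
    (visit : Kernel A (A × X)) [IsMarkovKernel visit] : Kernel (Node S A) (Node S A × X) where
  toFun := visitMeasure lam C α proposal init v visit
  measurable' := measurable_visitMeasure lam C α proposal hi hv visit

instance (lam C α : ℝ) (proposal : Kernel S X) [IsMarkovKernel proposal]
    {init : X → A} (hi : Measurable init) {v : A → ℝ} (hv : Measurable v)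
    (visit : Kernel A (A × X)) [IsMarkovKernel visit] :
    IsMarkovKernel (visitKernel lam C α proposal hi hv visit) :=
  ⟨isProbabilityMeasure_visitMeasure lam C α proposal hi v visit⟩

/-- The law of the state obtained by selecting a child of the node and then sampling from its
subtree by `sample`. -/
def Node.sample (lam : ℝ) (v : A → ℝ) (sample : A → Measure X) (ν : Node S A) : Measure X :=
  ∑ i, ENNReal.ofReal (ν.boltzmann lam v i) • sample (ν.child i)

end Node

/-- The data of the algorithm: the number `T` of denoising steps, the prior of `x_T`, the transition
kernels of the base model (`kernel t` is the law of `x_t` given `x_{t+1}`, used for `t < T`), the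
reward, the inverse temperature `lam`, and the parameters `C`, `α` of progressive widening. -/
structure Setup (X : Type*) [MeasurableSpace X] where
  T : ℕ
  prior : Measure X
  [isProbabilityMeasure_prior : IsProbabilityMeasure prior]
  kernel : ℕ → Kernel X X
  [isMarkovKernel_kernel : ∀ t, IsMarkovKernel (kernel t)]
  reward : X → ℝ
  measurable_reward : Measurable reward
  lam : ℝ
  C : ℝ
  α : ℝ

attribute [instance] Setup.isProbabilityMeasure_prior Setup.isMarkovKernel_kernel

/-- The tree below a node at time `t`: at `t = 0` a terminal state, at `t + 1` a node that carries
its state, its visit count and the subtrees of its children. -/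
def Subtree (X : Type*) : ℕ → Type _
  | 0 => X
  | t + 1 => Node X (Subtree X t)

instance instMeasurableSpaceSubtree (X : Type*) [m : MeasurableSpace X] :
    ∀ t, MeasurableSpace (Subtree X t)
  | 0 => m
  | t + 1 =>
    haveI := instMeasurableSpaceSubtree X t
    inferInstanceAs (MeasurableSpace (Node X (Subtree X t)))

/-- A newly created node at time `t` with a given state. -/
def newSubtree {X : Type*} : ∀ t, X → Subtree X t
  | 0 => fun x => x
  | _ + 1 => fun x => Node.new x

/-- The whole tree: the root is a dummy node at time `T + 1` without a state. -/
abbrev Tree (X : Type*) (T : ℕ) : Type _ := Node Unit (Subtree X T)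

/-- The initial tree: the root alone. -/
def rootTree (X : Type*) (T : ℕ) : Tree X T := Node.new ()

theorem measurable_newSubtree {X : Type*} [MeasurableSpace X] :
    ∀ t, Measurable (newSubtree t : X → Subtree X t)
  | 0 => measurable_id
  | _ + 1 => measurable_new

namespace Setup

variable {X : Type*} [MeasurableSpace X] (D : Setup X)

/-- The value estimate of a node at time `t`: the reward at a terminal node, the soft Bellman backup
of the values of the children elsewhere. A tree iteration backs up exactly the nodes whose subtree
it changes, so this is the estimate that the algorithm keeps at the node after every iteration. -/
def value : ∀ t, Subtree X t → ℝ
  | 0 => D.reward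
  | t + 1 => fun ν => Node.backup D.lam (value t) ν

theorem measurable_value : ∀ t, Measurable (D.value t)
  | 0 => D.measurable_reward
  | t + 1 => measurable_backup D.lam (measurable_value t)

/-- One tree iteration below a node at time `t`: the joint law of the updated subtree and of the
terminal state that is reached (selection, expansion, rollout, backup). -/
def visitAux : ∀ t, {κ : Kernel (Subtree X t) (Subtree X t × X) // IsMarkovKernel κ}
  | 0 => ⟨Kernel.deterministic (fun x : X => (x, x)) (by fun_prop),
      Kernel.isMarkovKernel_deterministic _⟩
  | t + 1 =>
    haveI := (visitAux t).2
    ⟨visitKernel D.lam D.C D.α (D.kernel t) (measurable_newSubtree t) (D.measurable_value t)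
      (visitAux t).1,
      inferInstanceAs (IsMarkovKernel (visitKernel D.lam D.C D.α (D.kernel t)
        (measurable_newSubtree t) (D.measurable_value t) (visitAux t).1))⟩

/-- One tree iteration below a node at time `t`, as a kernel. -/
def visit (t : ℕ) : Kernel (Subtree X t) (Subtree X t × X) := (D.visitAux t).1

instance (t : ℕ) : IsMarkovKernel (D.visit t) := (D.visitAux t).2

/-- One tree iteration: the joint law of the new tree and of the terminal state that is reached,
given the current tree. New children of the root are sampled from the prior. -/
def iteration : Kernel (Tree X D.T) (Tree X D.T × X) :=
  visitKernel D.lam D.C D.α (Kernel.const Unit D.prior) (measurable_newSubtree D.T)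
    (D.measurable_value D.T) (D.visit D.T)

instance : IsMarkovKernel D.iteration := by unfold iteration; infer_instance

/-- The law of the run of the algorithm: `ω m` is the pair of the tree after `m + 1` iterations and
the terminal state reached in the iteration number `m + 1`. -/
def run : Measure (ℕ → Tree X D.T × X) :=
  Kernel.trajMeasure (X := fun _ => Tree X D.T × X) (D.iteration (rootTree X D.T)) fun n =>
    D.iteration.comap (fun h => (h ⟨n, Finset.mem_Iic.2 le_rfl⟩).1) (by fun_prop)

/-- The law of a terminal state sampled from a subtree by selection steps alone. -/
def sampleSubtree : ∀ t, Subtree X t → Measure X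
  | 0 => fun x => Measure.dirac (x : X)
  | t + 1 => fun ν => Node.sample D.lam (D.value t) (sampleSubtree t) ν

/-- The law of a terminal state sampled from a tree by selection steps from the root. -/
def sampleTree (τ : Tree X D.T) : Measure X :=
  Node.sample D.lam (D.value D.T) (D.sampleSubtree D.T) τ

/-- The law of `x_0` given `x_t` under the base model. -/
def terminalKernel : ℕ → Kernel X X
  | 0 => Kernel.id
  | t + 1 => terminalKernel t ∘ₖ D.kernel t

/-- The marginal law of `x_0` under the base model. -/
def base : Measure X := D.prior.bind (D.terminalKernel D.T)

/-- The target: the probability measure proportional to `exp (lam * r x)` times the base law. -/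
def target : Measure X := D.base.tilted fun x => D.lam * D.reward x

end Setup

/-- The empirical distribution of the first `M` terms of a sequence. -/
def empirical {X : Type*} [MeasurableSpace X] (x : ℕ → X) (M : ℕ) : Measure X :=
  (M : ENNReal)⁻¹ • ∑ m ∈ Finset.range M, Measure.dirac (x m)

/-- Weak convergence of measures: convergence of the integrals of bounded continuous functions. -/
def WeaklyConverges {X : Type*} [MeasurableSpace X] [TopologicalSpace X]
    (μ : ℕ → Measure X) (ν : Measure X) : Prop :=
  ∀ f : BoundedContinuousFunction X ℝ, Tendsto (fun M => ∫ x, f x ∂μ M) atTop (𝓝 (∫ x, f x ∂ν))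

end DTS

end

/-!
Write `w = exp (lam * v)` for the exponential of the value estimate. The soft Bellman backup says
that `w` at a node is the average of `w` over its children, and Boltzmann selection gives each child
a weight proportional to its `w`. Hence, if `I` is the mean of a function `f` under sampling by
selection steps from a subtree, the product `w * I` is also the average of the same product over the
children, and both are iterated averages (`treeAverage`) of functions on the terminal states:
`exp (lam * r)` for `w` and `exp (lam * r) * f` for `w * I`. So it suffices to show that the iterated
average of any bounded measurable function `φ` converges almost surely to the mean of `φ` under the
base model (`Setup.ae_tendsto_rootAverage`); the ratio of two such limits is the mean under the tilted
measure.

This convergence is proved by induction over the height of the subtrees. The number of children of a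
node is a deterministic function of its visit count `N`, of the order of `N ^ α`
(`childCount`). The children are independent copies of the chain one level below, but the times at
which they are visited depend on their evolution. This is dealt with by one-step expectations alone:
almost sure convergence below is turned into a superharmonic function that dominates the error after
`J` visits and is small in the mean at birth, namely the Snell envelope of the error
(`controlledError_of_tendsto`). The average of a superharmonic function over the children is
asymptotically at most its mean at birth, since the product of `1 + c * h` over the children is a
supermartingale up to one factor for each birth, which gives a bound exponential in the number of
children (`ae_eventually_childSum_le`). The conserved quantity "mean under the base model given the
state of the child" is treated in the same way, which replaces the law of large numbers for the new
children. Finally, the proportion of children with fewer than `J` visits tends to zero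
(`ae_tendsto_childSum_pos_div`): such a child is selected with a probability at least proportional to
this proportion, but at most `J` times, and the number of children is sublinear in `N`.

For the terminal states reached by the iterations, the law of large numbers reduces their empirical
averages to those of their conditional laws given the tree. The conditional law differs from that of
sampling by selection steps by at most the probability of an expansion somewhere along the path
(`abs_integral_visitKernel_sub_le`), and the number of expansions in the whole tree is sublinear in
the number of iterations (`Node.exists_expansions_le`), because widening is sublinear at every level.
-/

namespace DTS

open scoped ENNReal

/-! ### Trajectories of a Markov chain with outputs -/

section Chain

variable {S O : Type*} [MeasurableSpace S] [MeasurableSpace O]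

/-- The law of the trajectory of the chain started at `s₀` that moves by the kernel `P`, each move
producing the next state together with an output. The starting state is not part of the trajectory:
the entry `k` is the result of the move number `k + 1`. -/
noncomputable def chain (P : Kernel S (S × O)) [IsMarkovKernel P] (s₀ : S) :
    Measure (ℕ → S × O) :=
  Kernel.trajMeasure (X := fun _ => S × O) (P s₀) fun n =>
    P.comap (fun h => (h ⟨n, Finset.mem_Iic.2 le_rfl⟩).1) (by fun_prop)

instance (P : Kernel S (S × O)) [IsMarkovKernel P] (s₀ : S) :
    IsProbabilityMeasure (chain P s₀) := by unfold chain; infer_instance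

/-- The state after `k` moves along the trajectory `ω`. -/
def stateAt (s₀ : S) (ω : ℕ → S × O) : ℕ → S
  | 0 => s₀
  | k + 1 => (ω k).1

theorem stateAt_succ {S O : Type*} (s₀ : S) (ω : ℕ → S × O) (k : ℕ) :
    stateAt s₀ ω (k + 1) = (ω k).1 := rfl

theorem stateAt_congr {S O : Type*} (s₀ : S) {k : ℕ} {ω ω' : ℕ → S × O} (h : ∀ i < k, ω i = ω' i) :
    stateAt s₀ ω k = stateAt s₀ ω' k := by
  cases k with
  | zero => rfl
  | succ k => simp only [stateAt, h k (Nat.lt_succ_self k)]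

theorem measurable_stateAt (s₀ : S) (k : ℕ) :
    Measurable fun ω : ℕ → S × O => stateAt s₀ ω k := by
  cases k with
  | zero => exact measurable_const
  | succ k => exact measurable_fst.comp (measurable_pi_apply k)

variable (P : Kernel S (S × O)) [IsMarkovKernel P] (s₀ : S)

theorem map_chain_zero : (chain P s₀).map (fun ω => ω 0) = P s₀ := by
  unfold chain Kernel.trajMeasure
  have h : (fun ω : ℕ → S × O => ω 0) =
      (fun h : (i : Finset.Iic 0) → S × O => h ⟨0, Finset.mem_Iic.2 le_rfl⟩) ∘
        Preorder.frestrictLe (π := fun _ => S × O) 0 := rfl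
  rw [h, ← Measure.map_map (by fun_prop) (by fun_prop), Measure.map_comp _ _ (by fun_prop),
    Kernel.traj_map_frestrictLe, Kernel.partialTraj_self, Measure.id_comp,
    Measure.map_map (by fun_prop) (by fun_prop)]
  exact Measure.map_id

/-- The Markov property: given the first `k` moves, the next one has the law `P` at the current
state. -/
theorem lintegral_chain_step (k : ℕ) {G : (ℕ → S × O) → ℝ≥0∞} (hG : Measurable G)
    (hGk : ∀ ω ω', (∀ i < k, ω i = ω' i) → G ω = G ω') {F : S → S × O → ℝ≥0∞}
    (hF : Measurable (Function.uncurry F)) :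
    ∫⁻ ω, G ω * F (stateAt s₀ ω k) (ω k) ∂chain P s₀ =
      ∫⁻ ω, G ω * ∫⁻ y, F (stateAt s₀ ω k) y ∂P (stateAt s₀ ω k) ∂chain P s₀ := by
  cases k with
  | zero =>
    obtain ⟨ω₀⟩ : Nonempty (ℕ → S × O) := (chain P s₀).nonempty_of_neZero
    have h : ∀ ω, G ω = G ω₀ := fun ω => hGk _ _ (by simp)
    simp only [h, stateAt]
    have hF' : Measurable (F s₀) := hF.comp measurable_prodMk_left
    have h0 : Measurable fun ω : ℕ → S × O => F s₀ (ω 0) := hF'.comp (measurable_pi_apply 0)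
    rw [lintegral_const_mul _ h0, lintegral_const, measure_univ, mul_one,
      ← lintegral_map (g := fun ω : ℕ → S × O => ω 0) hF' (measurable_pi_apply 0),
      map_chain_zero P s₀]
  | succ k =>
    have key := Kernel.map_frestrictLe_trajMeasure_compProd_eq_map_trajMeasure
      (X := fun _ => S × O) (μ₀ := P s₀) (κ := fun n =>
      P.comap (fun h : (i : Finset.Iic n) → S × O => (h ⟨n, Finset.mem_Iic.2 le_rfl⟩).1)
        (by fun_prop)) (a := k)
    let ext : ((i : Finset.Iic k) → S × O) → ℕ → S × O := fun h i =>
      if hi : i ≤ k then h ⟨i, Finset.mem_Iic.2 hi⟩ else h ⟨k, Finset.mem_Iic.2 le_rfl⟩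
    have hext : Measurable ext := by
      refine measurable_pi_lambda _ fun i => ?_
      by_cases hi : i ≤ k
      · simp only [ext, hi, dite_true]; fun_prop
      · simp only [ext, hi, dite_false]; fun_prop
    have hGe : ∀ ω : ℕ → S × O, G (ext (Preorder.frestrictLe k ω)) = G ω := fun ω =>
      hGk _ _ fun i hi => by
        have : i ≤ k := by omega
        simp [ext, this]
    let Φ : ((i : Finset.Iic k) → S × O) × (S × O) → ℝ≥0∞ := fun p =>
      G (ext p.1) * F (p.1 ⟨k, Finset.mem_Iic.2 le_rfl⟩).1 p.2
    have hΦ : Measurable Φ := by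
      refine (hG.comp (hext.comp measurable_fst)).mul ?_
      exact hF.comp (f := fun p : ((i : Finset.Iic k) → S × O) × (S × O) =>
        ((p.1 ⟨k, Finset.mem_Iic.2 le_rfl⟩).1, p.2)) (by fun_prop)
    have h1 := congrArg (fun ν => ∫⁻ p, Φ p ∂ν) key
    rw [lintegral_map hΦ (by fun_prop), Measure.lintegral_compProd hΦ,
      lintegral_map (by exact hΦ.lintegral_kernel_prod_right') (by fun_prop)] at h1
    refine Eq.trans ?_ (h1.symm.trans ?_)
    · refine lintegral_congr fun ω => ?_
      simp only [Φ, hGe, stateAt]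
      rfl
    · refine lintegral_congr fun ω => ?_
      simp only [Φ, hGe, stateAt]
      rw [lintegral_const_mul]
      · rfl
      · exact hF.comp measurable_prodMk_left

/-- A relation between a state and the result of the next move that holds almost surely from every
state holds almost surely along the trajectory. -/
theorem ae_chain_of_forall_ae {R : S → S × O → Prop}
    (hR : MeasurableSet {p : S × (S × O) | R p.1 p.2}) (h : ∀ s, ∀ᵐ y ∂P s, R s y) :
    ∀ᵐ ω ∂chain P s₀, ∀ k, R (stateAt s₀ ω k) (ω k) := by
  rw [ae_all_iff]
  intro k
  have hF : Measurable (Function.uncurry fun s y =>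
      Set.indicator {p : S × (S × O) | R p.1 p.2}ᶜ (fun _ => (1 : ℝ≥0∞)) (s, y)) :=
    measurable_const.indicator hR.compl
  have := lintegral_chain_step P s₀ k (G := fun _ => 1) measurable_const (fun _ _ _ => rfl) hF
  simp only [one_mul] at this
  have h0 : ∀ s, ∫⁻ y, Set.indicator {p : S × (S × O) | R p.1 p.2}ᶜ (fun _ => (1 : ℝ≥0∞)) (s, y)
      ∂P s = 0 := fun s => by
    rw [lintegral_eq_zero_iff (by exact hF.comp measurable_prodMk_left)]
    filter_upwards [h s] with y hy
    simp [hy]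
  simp only [h0, lintegral_zero] at this
  rw [lintegral_eq_zero_iff] at this
  · filter_upwards [this] with ω hω
    by_contra hc
    simp [hc] at hω
  · exact hF.comp (f := fun ω => (stateAt s₀ ω k, ω k))
      ((measurable_stateAt s₀ k).prodMk (measurable_pi_apply k))

/-- A measurable property preserved by every move holds almost surely along the trajectory. -/
theorem ae_chain_of_invariant {I : S → Prop} (hI : MeasurableSet {s | I s}) (h₀ : I s₀)
    (h : ∀ s, I s → ∀ᵐ y ∂P s, I y.1) : ∀ᵐ ω ∂chain P s₀, ∀ k, I (stateAt s₀ ω k) := by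
  have hR : MeasurableSet {p : S × (S × O) | I p.1 → I p.2.1} := by
    simp only [imp_iff_not_or]
    exact (measurable_fst hI).compl.union ((measurable_fst.comp measurable_snd) hI)
  have h' : ∀ s, ∀ᵐ y ∂P s, I s → I y.1 := fun s => by
    by_cases hs : I s
    · filter_upwards [h s hs] with y hy _ using hy
    · exact ae_of_all _ fun y hy => absurd hy hs
  filter_upwards [ae_chain_of_forall_ae P s₀ hR h'] with ω hω k
  induction k with
  | zero => exact h₀
  | succ k ih => exact hω k ih

end Chain

/-- First moments that are summable force almost sure convergence to zero. -/
theorem ae_eventually_lt_one_of_tsum_lintegral_ne_top {Ω : Type*} [MeasurableSpace Ω]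
    {μ : Measure Ω} {Z : ℕ → Ω → ℝ≥0∞} (hZ : ∀ k, Measurable (Z k))
    (h : ∑' k, ∫⁻ ω, Z k ω ∂μ ≠ ∞) : ∀ᵐ ω ∂μ, ∀ᶠ k in atTop, Z k ω < 1 := by
  rw [← lintegral_tsum fun k => (hZ k).aemeasurable] at h
  filter_upwards [ae_lt_top (Measurable.tsum hZ) h] with ω hω
  exact (ENNReal.tendsto_atTop_zero_of_tsum_ne_top hω.ne).eventually_lt_const one_pos

/-! ### The law of large numbers for a Markov chain -/

section LLN

variable {S O : Type*} [MeasurableSpace S] [MeasurableSpace O]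
variable (P : Kernel S (S × O)) [IsMarkovKernel P] (s₀ : S)

/-- A bound for exponential moments: for small `θ` the negative drift `-δ` outweighs the second
order term of the exponential. -/
theorem lintegral_exp_le {Ω : Type*} [MeasurableSpace Ω] {μ : Measure Ω} [IsProbabilityMeasure μ]
    {ξ : Ω → ℝ} (hξ : Measurable ξ) {K δ θ : ℝ} (hK : ∀ y, |ξ y| ≤ K) (h0 : ∫ y, ξ y ∂μ ≤ 0)
    (hθ : 0 ≤ θ) (hθK : θ * K ≤ 1) (hθδ : θ * K ^ 2 ≤ δ / 2) :
    ∫⁻ y, ENNReal.ofReal (Real.exp (θ * (ξ y - δ))) ∂μ ≤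
      ENNReal.ofReal (Real.exp (-(θ * δ / 2))) := by
  have hint : Integrable ξ μ := Integrable.of_bound hξ.aestronglyMeasurable K (ae_of_all _ hK)
  have hpt : ∀ y, Real.exp (θ * (ξ y - δ)) ≤
      Real.exp (-(θ * δ)) * (1 + θ * ξ y + θ ^ 2 * K ^ 2) := fun y => by
    have h1 : |θ * ξ y| ≤ 1 := by
      rw [abs_mul, abs_of_nonneg hθ]
      exact (mul_le_mul_of_nonneg_left (hK y) hθ).trans hθK
    have h2 := (abs_le.1 (Real.abs_exp_sub_one_sub_id_le h1)).2
    have h3 : (θ * ξ y) ^ 2 ≤ θ ^ 2 * K ^ 2 := by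
      rw [mul_pow]
      exact mul_le_mul_of_nonneg_left (sq_le_sq' (abs_le.1 (hK y)).1 (abs_le.1 (hK y)).2)
        (sq_nonneg _)
    have : θ * (ξ y - δ) = -(θ * δ) + θ * ξ y := by ring
    rw [this, Real.exp_add]
    exact mul_le_mul_of_nonneg_left (by linarith) (Real.exp_pos _).le
  have hint' : Integrable (fun y => Real.exp (-(θ * δ)) * (1 + θ * ξ y + θ ^ 2 * K ^ 2)) μ :=
    ((((integrable_const _).add (hint.const_mul θ))).add (integrable_const _)).const_mul _
  refine (lintegral_mono fun y => ENNReal.ofReal_le_ofReal (hpt y)).trans ?_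
  rw [← ofReal_integral_eq_lintegral_ofReal hint'
    (ae_of_all _ fun y => (Real.exp_pos _).le.trans (hpt y))]
  refine ENNReal.ofReal_le_ofReal ?_
  rw [integral_const_mul, integral_add (by exact (integrable_const _).add (hint.const_mul θ))
    (integrable_const _), integral_add (integrable_const _) (hint.const_mul θ),
    integral_const_mul]
  simp only [integral_const, probReal_univ, smul_eq_mul, one_mul]
  have h4 : 1 + θ * ∫ y, ξ y ∂μ + θ ^ 2 * K ^ 2 ≤ Real.exp (θ * δ / 2) := by
    have h5 := Real.add_one_le_exp (θ * δ / 2)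
    have h6 : θ * ∫ y, ξ y ∂μ ≤ 0 := mul_nonpos_of_nonneg_of_nonpos hθ h0
    nlinarith
  refine (mul_le_mul_of_nonneg_left h4 (Real.exp_pos _).le).trans ?_
  rw [← Real.exp_add]
  exact le_of_eq (by ring_nf)

/-- One half of the law of large numbers for bounded increments with nonpositive drift. -/
theorem ae_eventually_sum_le {ξ : S → S × O → ℝ} (hξ : Measurable (Function.uncurry ξ)) {K : ℝ}
    (hK : ∀ s y, |ξ s y| ≤ K) (h0 : ∀ s, ∫ y, ξ s y ∂P s ≤ 0) {δ : ℝ} (hδ : 0 < δ) :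
    ∀ᵐ ω ∂chain P s₀, ∀ᶠ k : ℕ in atTop,
      ∑ m ∈ Finset.range k, ξ (stateAt s₀ ω m) (ω m) ≤ δ * k := by
  obtain ⟨θ, hθ, hθK, hθδ⟩ : ∃ θ : ℝ, 0 < θ ∧ θ * K ≤ 1 ∧ θ * K ^ 2 ≤ δ / 2 := by
    have hK0 : 0 ≤ K := by
      obtain ⟨y⟩ : Nonempty (S × O) := (P s₀).nonempty_of_neZero
      exact (abs_nonneg _).trans (hK s₀ y)
    refine ⟨min (1 / (K + 1)) (δ / 2 / (K ^ 2 + 1)), by positivity, ?_, ?_⟩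
    · refine (mul_le_mul_of_nonneg_right (min_le_left _ _) hK0).trans ?_
      rw [div_mul_eq_mul_div, div_le_one (by positivity)]; linarith
    · refine (mul_le_mul_of_nonneg_right (min_le_right _ _) (sq_nonneg K)).trans ?_
      rw [div_mul_eq_mul_div, div_le_iff₀ (by positivity)]; nlinarith
  let f : S → S × O → ℝ≥0∞ := fun s y => ENNReal.ofReal (Real.exp (θ * (ξ s y - δ)))
  have hf : Measurable (Function.uncurry f) :=
    (Real.measurable_exp.comp ((hξ.sub_const δ).const_mul θ)).ennreal_ofReal
  have hf' : ∀ m, Measurable fun ω : ℕ → S × O => f (stateAt s₀ ω m) (ω m) := fun m =>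
    hf.comp (f := fun ω : ℕ → S × O => (stateAt s₀ ω m, ω m))
      ((measurable_stateAt s₀ m).prodMk (measurable_pi_apply m))
  -- `Z k = exp (θ * (∑ ξ - δ * k))`, the sum being over the first `k` moves, decays geometrically
  -- in the mean.
  let Z : ℕ → (ℕ → S × O) → ℝ≥0∞ := fun k ω =>
    ∏ m ∈ Finset.range k, f (stateAt s₀ ω m) (ω m)
  have hZ : ∀ k, Measurable (Z k) := fun k => Finset.measurable_prod _ fun m _ => hf' m
  have hEZ : ∀ k, ∫⁻ ω, Z k ω ∂chain P s₀ ≤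
      ENNReal.ofReal (Real.exp (-(θ * δ / 2))) ^ k := fun k => by
    induction k with
    | zero => simp [Z]
    | succ k ih =>
      simp only [Z, Finset.prod_range_succ]
      rw [lintegral_chain_step P s₀ k (hZ k) ?_ hf, pow_succ]
      · refine (lintegral_mono fun ω => mul_le_mul_right (lintegral_exp_le
          (hξ.comp measurable_prodMk_left) (hK _) (h0 _) hθ.le hθK hθδ) _).trans ?_
        rw [lintegral_mul_const _ (hZ k)]
        exact mul_le_mul_left ih _
      · intro ω ω' h
        refine Finset.prod_congr rfl fun m hm => ?_
        have hm' := Finset.mem_range.1 hm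
        rw [h m hm', stateAt_congr s₀ fun i hi => h i (hi.trans hm')]
  have hsum : ∑' k, ∫⁻ ω, Z k ω ∂chain P s₀ ≠ ∞ := by
    refine ne_top_of_le_ne_top ?_ (ENNReal.tsum_le_tsum hEZ)
    rw [ENNReal.tsum_geometric]
    refine ENNReal.inv_ne_top.2 (tsub_pos_of_lt ?_).ne'
    rw [← ENNReal.ofReal_one]
    refine (ENNReal.ofReal_lt_ofReal_iff one_pos).2 (Real.exp_lt_one_iff.2 ?_)
    have : 0 < θ * δ := by positivity
    linarith
  filter_upwards [ae_eventually_lt_one_of_tsum_lintegral_ne_top hZ hsum] with ω hω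
  filter_upwards [hω] with k hk
  simp only [Z, f] at hk
  rw [← ENNReal.ofReal_prod_of_nonneg fun i _ => (Real.exp_pos _).le, ← Real.exp_sum,
    ENNReal.ofReal_lt_one, Real.exp_lt_one_iff, ← Finset.mul_sum] at hk
  have := (pos_iff_neg_of_mul_neg hk).1 hθ
  rw [Finset.sum_sub_distrib] at this
  simp only [Finset.sum_const, Finset.card_range, nsmul_eq_mul] at this
  linarith

/-- The law of large numbers: the averages of a bounded function of the moves and those of its
conditional expectations have the same limit points. -/
theorem tendsto_average_sub_condExp {F : S → S × O → ℝ} (hF : Measurable (Function.uncurry F))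
    {K : ℝ} (hK : ∀ s y, |F s y| ≤ K) :
    ∀ᵐ ω ∂chain P s₀, Tendsto (fun k : ℕ => (∑ m ∈ Finset.range k,
      (F (stateAt s₀ ω m) (ω m) - ∫ y, F (stateAt s₀ ω m) y ∂P (stateAt s₀ ω m))) / k)
      atTop (𝓝 0) := by
  have hI : Measurable fun s => ∫ y, F s y ∂P s :=
    (StronglyMeasurable.integral_kernel_prod_right' hF.stronglyMeasurable).measurable
  have hFs : ∀ s, Integrable (F s) (P s) := fun s =>
    Integrable.of_bound (hF.comp measurable_prodMk_left).aestronglyMeasurable K (ae_of_all _ (hK s))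
  have hIK : ∀ s, |∫ y, F s y ∂P s| ≤ K := fun s => by
    have := norm_integral_le_of_norm_le_const (μ := P s) (f := F s) (ae_of_all _ (hK s))
    simpa using this
  let ξ : S → S × O → ℝ := fun s y => F s y - ∫ y, F s y ∂P s
  have hξ : Measurable (Function.uncurry ξ) := hF.sub (hI.comp measurable_fst)
  have hξK : ∀ s y, |ξ s y| ≤ 2 * K := fun s y => by
    have h1 := abs_le.1 (hK s y)
    have h2 := abs_le.1 (hIK s)
    exact abs_le.2 ⟨by simp only [ξ]; linarith, by simp only [ξ]; linarith⟩
  have hξ0 : ∀ s, ∫ y, ξ s y ∂P s = 0 := fun s => by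
    simp only [ξ]
    rw [integral_sub (hFs s) (integrable_const _)]
    simp
  have h1 : ∀ᵐ ω ∂chain P s₀, ∀ n : ℕ, ∀ᶠ k : ℕ in atTop,
      ∑ m ∈ Finset.range k, ξ (stateAt s₀ ω m) (ω m) ≤ (1 / ((n : ℝ) + 1)) * k :=
    ae_all_iff.2 fun n => ae_eventually_sum_le P s₀ hξ hξK (fun s => (hξ0 s).le) (by positivity)
  have h2 : ∀ᵐ ω ∂chain P s₀, ∀ n : ℕ, ∀ᶠ k : ℕ in atTop,
      ∑ m ∈ Finset.range k, -ξ (stateAt s₀ ω m) (ω m) ≤ (1 / ((n : ℝ) + 1)) * k :=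
    ae_all_iff.2 fun n => ae_eventually_sum_le P s₀ (ξ := fun s y => -ξ s y) hξ.neg
      (fun s y => by rw [abs_neg]; exact hξK s y)
      (fun s => by rw [integral_neg, hξ0, neg_zero]) (by positivity)
  filter_upwards [h1, h2] with ω h1 h2
  rw [Metric.tendsto_atTop']
  intro ε hε
  obtain ⟨n, hn⟩ := exists_nat_one_div_lt hε
  obtain ⟨k₀, hk₀⟩ := eventually_atTop.1 ((h1 n).and (h2 n))
  refine ⟨k₀, fun k hk => ?_⟩
  obtain ⟨ha, hb⟩ := hk₀ k hk.le
  have hk0 : (0 : ℝ) < k := by exact_mod_cast (Nat.zero_le _).trans_lt hk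
  rw [Finset.sum_neg_distrib] at hb
  rw [Real.dist_eq, sub_zero, abs_div, abs_of_pos hk0, div_lt_iff₀ hk0]
  exact (abs_le.2 ⟨by linarith, ha⟩).trans_lt (mul_lt_mul_of_pos_right hn hk0)

end LLN

/-! ### The Snell envelope -/

section Snell

variable {S O : Type*} [MeasurableSpace S] [MeasurableSpace O]
variable (P : Kernel S (S × O)) (d : S → ℝ≥0∞)

/-- The largest expected value of `d` at a stopping time that is at most `n`. -/
noncomputable def snellAux : ℕ → S → ℝ≥0∞
  | 0 => d
  | n + 1 => fun s => max (d s) (∫⁻ y, snellAux n y.1 ∂P s)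

/-- The Snell envelope of `d`, its least superharmonic majorant: the value of stopping the chain
optimally when the gain is `d`. -/
noncomputable def snell (s : S) : ℝ≥0∞ := ⨆ n, snellAux P d n s

variable {P d}

theorem snellAux_succ (n : ℕ) (s : S) :
    snellAux P d (n + 1) s = max (d s) (∫⁻ y, snellAux P d n y.1 ∂P s) := rfl

theorem measurable_snellAux (hd : Measurable d) : ∀ n, Measurable (snellAux P d n)
  | 0 => hd
  | n + 1 => hd.max (((measurable_snellAux hd n).comp measurable_fst).lintegral_kernel)

theorem measurable_snell (hd : Measurable d) : Measurable (snell P d) :=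
  Measurable.iSup fun n => measurable_snellAux hd n

theorem le_snell (s : S) : d s ≤ snell P d s := le_iSup (fun n => snellAux P d n s) 0

theorem snellAux_le_succ (n : ℕ) (s : S) : snellAux P d n s ≤ snellAux P d (n + 1) s := by
  induction n generalizing s with
  | zero => exact le_max_left _ _
  | succ n ih => exact max_le_max le_rfl (lintegral_mono fun y => ih y.1)

theorem lintegral_snell_le (hd : Measurable d) (s : S) :
    ∫⁻ y, snell P d y.1 ∂P s ≤ snell P d s := by
  unfold snell
  rw [lintegral_iSup (fun n => by exact (measurable_snellAux hd n).comp measurable_fst)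
    (monotone_nat_of_le_succ fun n y => snellAux_le_succ n y.1)]
  exact iSup_le fun n => (le_max_right _ _).trans (le_iSup (fun n => snellAux P d n s) (n + 1))

variable [IsMarkovKernel P]

theorem snell_le {c : ℝ≥0∞} (hc : ∀ s, d s ≤ c) (s : S) : snell P d s ≤ c := by
  refine iSup_le fun n => ?_
  induction n generalizing s with
  | zero => exact hc s
  | succ n ih =>
    refine max_le (hc s) ((lintegral_mono fun y : S × O => ih y.1).trans ?_)
    simp

/-- No stopping rule gains more than the largest value of `d` along the trajectory. -/
theorem snell_le_lintegral_iSup (hd : Measurable d) (s₀ : S) :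
    snell P d s₀ ≤ ∫⁻ ω, ⨆ k, d (stateAt s₀ ω k) ∂chain P s₀ := by
  have hdm : ∀ m, Measurable fun ω : ℕ → S × O => d (stateAt s₀ ω m) := fun m =>
    hd.comp (measurable_stateAt s₀ m)
  have key : ∀ n m, ∀ G : (ℕ → S × O) → ℝ≥0∞, Measurable G →
      (∀ ω ω', (∀ i < m, ω i = ω' i) → G ω = G ω') →
      ∫⁻ ω, G ω * snellAux P d n (stateAt s₀ ω m) ∂chain P s₀ ≤
        ∫⁻ ω, G ω * ⨆ k, d (stateAt s₀ ω k) ∂chain P s₀ := by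
    intro n
    induction n with
    | zero =>
      intro m G _ _
      exact lintegral_mono fun ω => mul_le_mul_right (le_iSup (fun k => d (stateAt s₀ ω k)) m) _
    | succ n ih =>
      intro m G hG hGm
      -- `A` is the event that stopping after `m` moves is at least as good as going on.
      let B : Set S := {s | ∫⁻ y, snellAux P d n y.1 ∂P s ≤ d s}
      have hB : MeasurableSet B := measurableSet_le
        ((measurable_snellAux hd n).comp measurable_fst).lintegral_kernel hd
      let A : Set (ℕ → S × O) := {ω | stateAt s₀ ω m ∈ B}
      have hA : MeasurableSet A := measurable_stateAt s₀ m hB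
      have hAm : ∀ ω ω', (∀ i < m, ω i = ω' i) → (ω ∈ A ↔ ω' ∈ A) := fun ω ω' h => by
        simp only [A, Set.mem_ofPred_eq, stateAt_congr s₀ h]
      have hsplit : ∀ H : (ℕ → S × O) → ℝ≥0∞, Measurable H → ∫⁻ ω, G ω * H ω ∂chain P s₀ =
          ∫⁻ ω, A.indicator G ω * H ω ∂chain P s₀ + ∫⁻ ω, Aᶜ.indicator G ω * H ω ∂chain P s₀ := by
        intro H hH
        rw [← lintegral_add_left (by exact (hG.indicator hA).mul hH)]
        refine lintegral_congr fun ω => ?_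
        by_cases h : ω ∈ A <;> simp [h]
      rw [hsplit _ (by exact (measurable_snellAux hd (n + 1)).comp (measurable_stateAt s₀ m)),
        hsplit _ (Measurable.iSup hdm)]
      refine add_le_add ?_ ?_
      · refine lintegral_mono fun ω => ?_
        by_cases h : ω ∈ A
        · refine mul_le_mul_right ?_ _
          rw [snellAux_succ, max_eq_left (show _ ≤ _ from h)]
          exact le_iSup (fun k => d (stateAt s₀ ω k)) m
        · simp [h]
      · have h1 : ∫⁻ ω, Aᶜ.indicator G ω * snellAux P d (n + 1) (stateAt s₀ ω m) ∂chain P s₀ =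
            ∫⁻ ω, Aᶜ.indicator G ω *
              ∫⁻ y, snellAux P d n y.1 ∂P (stateAt s₀ ω m) ∂chain P s₀ := by
          refine lintegral_congr fun ω => ?_
          by_cases h : ω ∈ A
          · simp [h]
          · rw [snellAux_succ, max_eq_right (le_of_lt (not_le.1 h))]
        have hGA : ∀ ω ω', (∀ i < m, ω i = ω' i) → Aᶜ.indicator G ω = Aᶜ.indicator G ω' := by
          intro ω ω' h
          by_cases hω : ω ∈ A
          · simp [hω, (hAm ω ω' h).1 hω]
          · have hω' : ω' ∉ A := fun hc => hω ((hAm ω ω' h).2 hc)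
            simp [hω, hω', hGm ω ω' h]
        rw [h1, ← lintegral_chain_step P s₀ m (hG.indicator hA.compl) hGA
          (F := fun _ y => snellAux P d n y.1)
          ((measurable_snellAux hd n).comp (measurable_fst.comp measurable_snd))]
        exact ih (m + 1) _ (hG.indicator hA.compl)
          fun ω ω' h => hGA ω ω' fun i hi => h i (hi.trans (Nat.lt_succ_self m))
  refine iSup_le fun n => ?_
  have := key n 0 (fun _ => 1) measurable_const fun _ _ _ => rfl
  simpa [stateAt] using this

end Snell

/-! ### Progressive widening -/

section Widening

/-- The number of children of a node after `k` iterations have passed through it. Its visit count is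
then `k + 1`, so progressive widening leaves no randomness in the number of children. -/
noncomputable def childCount (C α : ℝ) : ℕ → ℕ
  | 0 => 0
  | k + 1 =>
    open Classical in
    if childCount C α k = 0 ∨ (childCount C α k : ℝ) < C * ((k + 1 : ℕ) : ℝ) ^ α then
      childCount C α k + 1 else childCount C α k

variable {C α : ℝ}

theorem childCount_succ_of_expandable {k : ℕ}
    (h : childCount C α k = 0 ∨ (childCount C α k : ℝ) < C * ((k + 1 : ℕ) : ℝ) ^ α) :
    childCount C α (k + 1) = childCount C α k + 1 := by
  rw [childCount, if_pos h]

theorem childCount_succ_of_not_expandable {k : ℕ}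
    (h : ¬(childCount C α k = 0 ∨ (childCount C α k : ℝ) < C * ((k + 1 : ℕ) : ℝ) ^ α)) :
    childCount C α (k + 1) = childCount C α k := by
  rw [childCount, if_neg h]

theorem childCount_le_succ (k : ℕ) : childCount C α k ≤ childCount C α (k + 1) := by
  rw [childCount]; split_ifs <;> omega

theorem childCount_mono : Monotone (childCount C α) := monotone_nat_of_le_succ childCount_le_succ

theorem childCount_pos (k : ℕ) : 0 < childCount C α (k + 1) := by
  rw [childCount]; split_ifs with h
  · omega
  · push Not at h; omega

/-- The upper half of the asymptotics `C * k ^ α` of the number of children; the lower half is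
`eventually_le_childCount`. -/
theorem childCount_le (hC : 0 < C) (hα : α ∈ Set.Ioo (0 : ℝ) 1) (k : ℕ) :
    (childCount C α k : ℝ) ≤ C * (k : ℝ) ^ α + 1 := by
  induction k with
  | zero => simp [childCount, hα.1.ne']
  | succ k ih =>
    by_cases h : childCount C α k = 0 ∨ (childCount C α k : ℝ) < C * ((k + 1 : ℕ) : ℝ) ^ α
    · rw [childCount_succ_of_expandable h]
      have hpos : 0 ≤ C * ((k + 1 : ℕ) : ℝ) ^ α := by positivity
      rcases h with h | h
      · rw [h]; push_cast at hpos ⊢; linarith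
      · push_cast at h ⊢; linarith
    · rw [childCount_succ_of_not_expandable h]
      refine ih.trans ?_
      gcongr
      · exact hα.1.le
      · omega

theorem tendsto_mul_rpow_div (hα : α ∈ Set.Ioo (0 : ℝ) 1) (c : ℝ) :
    Tendsto (fun k : ℕ => c * (k : ℝ) ^ α / k) atTop (𝓝 0) := by
  have h : Tendsto (fun k : ℕ => c * (k : ℝ) ^ (-(1 - α))) atTop (𝓝 (c * 0)) :=
    ((tendsto_rpow_neg_atTop (by linarith [hα.2])).comp tendsto_natCast_atTop_atTop).const_mul c
  rw [mul_zero] at h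
  refine h.congr' ?_
  filter_upwards [eventually_gt_atTop 0] with k hk
  have hk' : (0 : ℝ) < k := by exact_mod_cast hk
  rw [mul_div_assoc, show -(1 - α) = α - 1 by ring, Real.rpow_sub_one hk'.ne']

theorem tendsto_childCount_div (hC : 0 < C) (hα : α ∈ Set.Ioo (0 : ℝ) 1) :
    Tendsto (fun k : ℕ => (childCount C α k : ℝ) / k) atTop (𝓝 0) := by
  have h := (tendsto_mul_rpow_div hα C).add (tendsto_one_div_atTop_nhds_zero_nat (𝕜 := ℝ))
  rw [add_zero] at h
  refine squeeze_zero (fun k => by positivity) (fun k => ?_) h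
  rw [← add_div]
  exact div_le_div_of_nonneg_right (childCount_le hC hα k) (Nat.cast_nonneg k)

/-- From some time on, progressive widening keeps up with the bound `C * k ^ α`, which then grows by
at most one in each step. -/
theorem eventually_le_childCount (hC : 0 < C) (hα : α ∈ Set.Ioo (0 : ℝ) 1) :
    ∀ᶠ k : ℕ in atTop, C * (k : ℝ) ^ α ≤ childCount C α k := by
  have h1 : ∀ᶠ k : ℕ in atTop, C * ((k + 1 : ℕ) : ℝ) ^ α ≤ C * (k : ℝ) ^ α + 1 := by
    filter_upwards [(tendsto_mul_rpow_div hα (C * α)).eventually_le_const one_pos,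
      eventually_gt_atTop 0] with k hk hk0
    have hk' : (0 : ℝ) < k := by exact_mod_cast hk0
    have h2 : ((k + 1 : ℕ) : ℝ) = k * (1 + 1 / k) := by push_cast; field_simp
    have h3 : (1 + 1 / (k : ℝ)) ^ α ≤ 1 + α * (1 / k) :=
      rpow_one_add_le_one_add_mul_self (by linarith [one_div_pos.2 hk']) hα.1.le hα.2.le
    rw [h2, Real.mul_rpow hk'.le (by positivity)]
    calc C * ((k : ℝ) ^ α * (1 + 1 / (k : ℝ)) ^ α)
        ≤ C * ((k : ℝ) ^ α * (1 + α * (1 / k))) := by gcongr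
      _ = C * (k : ℝ) ^ α + C * α * (k : ℝ) ^ α / k := by field_simp
      _ ≤ _ := by linarith
  obtain ⟨k₀, hk₀⟩ := eventually_atTop.1 h1
  -- As long as the number of children is too small, it grows by one in each step: this is faster
  -- than `C * k ^ α`, and so cannot last.
  obtain ⟨k₁, hk₁, h₁⟩ : ∃ k₁ ≥ k₀, C * (k₁ : ℝ) ^ α ≤ childCount C α k₁ := by
    by_contra! hcon
    have hgrow : ∀ j, j ≤ childCount C α (k₀ + j) := fun j => by
      induction j with
      | zero => exact Nat.zero_le _
      | succ j ih =>
        have h : (childCount C α (k₀ + j) : ℝ) < C * ((k₀ + j + 1 : ℕ) : ℝ) ^ α := by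
          refine (hcon (k₀ + j) (by omega)).trans_le ?_
          have : ((k₀ + j : ℕ) : ℝ) ≤ ((k₀ + j + 1 : ℕ) : ℝ) := by exact_mod_cast Nat.le_succ _
          exact mul_le_mul_of_nonneg_left
            (Real.rpow_le_rpow (Nat.cast_nonneg _) this hα.1.le) hC.le
        rw [← add_assoc, childCount_succ_of_expandable (Or.inr h)]
        omega
    have h := ((tendsto_childCount_div hC hα).eventually_lt_const
      (show (0 : ℝ) < 1 / 2 by norm_num)).and (eventually_gt_atTop (2 * k₀))
    obtain ⟨k, hk, hk'⟩ := h.exists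
    have hk0 : (0 : ℝ) < k := by exact_mod_cast (Nat.zero_le _).trans_lt hk'
    rw [div_lt_iff₀ hk0] at hk
    have h4 := hgrow (k - k₀)
    rw [show k₀ + (k - k₀) = k by omega] at h4
    have h5 : (k : ℝ) ≤ childCount C α k + k₀ := by exact_mod_cast (by omega : k ≤ _ + k₀)
    have h6 : (2 * k₀ : ℝ) < k := by exact_mod_cast hk'
    linarith
  filter_upwards [eventually_ge_atTop k₁] with k hk
  induction k, hk using Nat.le_induction with
  | base => exact h₁
  | succ k hk ih =>
    by_cases h : childCount C α k = 0 ∨ (childCount C α k : ℝ) < C * ((k + 1 : ℕ) : ℝ) ^ α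
    · rw [childCount_succ_of_expandable h]
      refine (hk₀ k (by omega)).trans ?_
      push_cast
      linarith
    · rw [childCount_succ_of_not_expandable h]
      push Not at h
      exact h.2

theorem tendsto_childCount (hC : 0 < C) (hα : α ∈ Set.Ioo (0 : ℝ) 1) :
    Tendsto (fun k : ℕ => (childCount C α k : ℝ)) atTop atTop :=
  tendsto_atTop_mono' _ (eventually_le_childCount hC hα)
    (((tendsto_rpow_atTop hα.1).comp tendsto_natCast_atTop_atTop).const_mul_atTop hC)

theorem summable_exp_neg_childCount (hC : 0 < C) (hα : α ∈ Set.Ioo (0 : ℝ) 1) {c : ℝ}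
    (hc : 0 < c) : Summable fun k : ℕ => Real.exp (-(c * childCount C α k)) := by
  have h1 : (fun k : ℕ => Real.exp (-(c * C) * (k : ℝ) ^ α)) =o[atTop]
      fun k : ℕ => (k : ℝ) ^ (-2 : ℝ) := by
    have := ((isLittleO_exp_neg_mul_rpow_atTop (mul_pos hc hC) (-2 / α)).comp_tendsto
      (tendsto_rpow_atTop hα.1)).comp_tendsto tendsto_natCast_atTop_atTop
    refine this.congr (fun k => rfl) fun k => ?_
    simp only [Function.comp_apply]
    rw [← Real.rpow_mul (Nat.cast_nonneg k), mul_div_cancel₀ _ hα.1.ne']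
  refine summable_of_isBigO_nat (Real.summable_nat_rpow.2 (by norm_num : (-2 : ℝ) < -1))
    (Asymptotics.IsBigO.trans ?_ h1.isBigO)
  refine Asymptotics.IsBigO.of_bound 1 ?_
  filter_upwards [eventually_le_childCount hC hα] with k hk
  rw [one_mul, Real.norm_of_nonneg (Real.exp_pos _).le, Real.norm_of_nonneg (Real.exp_pos _).le]
  refine Real.exp_le_exp.2 ?_
  have := mul_le_mul_of_nonneg_left hk hc.le
  linarith

/-- The number of children varies slowly: few of the children present at time `k` were created
during the last `δ * k` iterations. -/
theorem exists_childCount_sub_le (hC : 0 < C) (hα : α ∈ Set.Ioo (0 : ℝ) 1) {ε : ℝ} (hε : 0 < ε) :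
    ∃ δ ∈ Set.Ioo (0 : ℝ) 1, ∀ᶠ k : ℕ in atTop, ∀ m : ℕ, (1 - δ) * k ≤ m →
      (childCount C α k : ℝ) - childCount C α m ≤ ε * childCount C α k := by
  obtain ⟨δ, ⟨hδ0, hδ1⟩, hδε⟩ : ∃ δ ∈ Set.Ioo (0 : ℝ) 1, δ ≤ ε / 2 :=
    ⟨min (ε / 2) (1 / 2), ⟨by positivity, (min_le_right _ _).trans_lt (by norm_num)⟩,
      min_le_left _ _⟩
  refine ⟨δ, ⟨hδ0, hδ1⟩, ?_⟩
  obtain ⟨k₀, hk₀⟩ := eventually_atTop.1 (eventually_le_childCount hC hα)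
  filter_upwards [(tendsto_natCast_atTop_atTop (R := ℝ)).eventually_ge_atTop (k₀ / (1 - δ)),
    (tendsto_childCount hC hα).eventually_ge_atTop (2 / ε), eventually_ge_atTop k₀]
    with k hk hk' hk'' m hm
  have h1δ : 0 < 1 - δ := by linarith
  have hm0 : k₀ ≤ m := by
    rw [div_le_iff₀ h1δ] at hk
    exact_mod_cast (hk.trans (by linarith : (k : ℝ) * (1 - δ) ≤ m))
  have h1 := hk₀ m hm0
  have h2 : (1 - δ) * (C * (k : ℝ) ^ α) ≤ C * (m : ℝ) ^ α := by
    calc (1 - δ) * (C * (k : ℝ) ^ α) ≤ (1 - δ) ^ α * (C * (k : ℝ) ^ α) := by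
          refine mul_le_mul_of_nonneg_right ?_ (by positivity)
          exact Real.self_le_rpow_of_le_one h1δ.le (by linarith) hα.2.le
      _ = C * ((1 - δ) * k) ^ α := by rw [Real.mul_rpow h1δ.le (Nat.cast_nonneg k)]; ring
      _ ≤ C * (m : ℝ) ^ α := by
          gcongr
          exact hα.1.le
  have h3 := childCount_le hC hα k
  have h4 := hk₀ k hk''
  have h5 : 1 ≤ ε / 2 * childCount C α k := by
    rw [div_le_iff₀ hε] at hk'
    linarith
  have h6 : δ * (C * (k : ℝ) ^ α) ≤ ε / 2 * childCount C α k :=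
    mul_le_mul hδε h4 (by positivity) (by positivity)
  linarith

/-- A quantity that grows at most as fast as the number of children, and whose ratio to it tends
to zero in the sense of Cesàro, is negligible against it. -/
theorem tendsto_div_childCount_of_cesaro (hC : 0 < C) (hα : α ∈ Set.Ioo (0 : ℝ) 1) {L : ℕ → ℝ}
    (hL0 : ∀ k, 0 ≤ L k)
    (hL : ∀ m k, m ≤ k → L k ≤ L m + (childCount C α k - childCount C α m))
    (h : Tendsto (fun k : ℕ => (∑ m ∈ Finset.range k, L m / childCount C α m) / k) atTop (𝓝 0)) :
    Tendsto (fun k => L k / childCount C α k) atTop (𝓝 0) := by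
  refine tendsto_order.2 ⟨fun a ha => Eventually.of_forall fun k =>
    ha.trans_le (div_nonneg (hL0 k) (Nat.cast_nonneg _)), fun ε hε => ?_⟩
  obtain ⟨δ, ⟨hδ0, hδ1⟩, hδ⟩ := exists_childCount_sub_le hC hα (half_pos hε)
  filter_upwards [hδ, h.eventually_lt_const (show 0 < δ * ε / 4 by positivity),
    (tendsto_natCast_atTop_atTop (R := ℝ)).eventually_ge_atTop (2 / δ), eventually_gt_atTop 0]
    with k h1 h2 h3 hk
  have hk0 : (0 : ℝ) < k := by exact_mod_cast hk
  have hnk : ∀ m, 0 < m → (0 : ℝ) < childCount C α m := fun m hm => by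
    obtain ⟨m, rfl⟩ := Nat.exists_eq_succ_of_ne_zero hm.ne'
    exact_mod_cast childCount_pos m
  by_contra! hcon
  rw [le_div_iff₀ (hnk k hk)] at hcon
  -- If the ratio were at least `ε` at time `k`, it would be at least `ε / 2` from `a` to `k`.
  set a := ⌈(1 - δ) * k⌉₊ with ha
  have ha0 : 0 < a := Nat.ceil_pos.2 (mul_pos (by linarith) hk0)
  have hak : a ≤ k := Nat.ceil_le.2 (by nlinarith)
  have hsum : (ε / 2) * ((k : ℝ) - a) ≤ ∑ m ∈ Finset.range k, L m / childCount C α m := by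
    calc (ε / 2) * ((k : ℝ) - a) = ∑ m ∈ Finset.Ico a k, ε / 2 := by
          rw [Finset.sum_const, Nat.card_Ico, nsmul_eq_mul, Nat.cast_sub hak, mul_comm]
      _ ≤ ∑ m ∈ Finset.Ico a k, L m / childCount C α m := by
          refine Finset.sum_le_sum fun m hm => ?_
          obtain ⟨hm1, hm2⟩ := Finset.mem_Ico.1 hm
          rw [le_div_iff₀ (hnk m (ha0.trans_le hm1))]
          have h4 := h1 m ((Nat.le_ceil _).trans (by exact_mod_cast hm1))
          have h5 := hL m k hm2.le
          have h6 : (childCount C α m : ℝ) ≤ childCount C α k := by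
            exact_mod_cast childCount_mono hm2.le
          nlinarith
      _ ≤ _ := by
          refine Finset.sum_le_sum_of_subset_of_nonneg (fun m hm => ?_) fun m _ _ =>
            div_nonneg (hL0 m) (Nat.cast_nonneg _)
          exact Finset.mem_range.2 (Finset.mem_Ico.1 hm).2
  rw [div_lt_iff₀ hk0] at h2
  have h7 : (a : ℝ) < (1 - δ) * k + 1 := Nat.ceil_lt_add_one (mul_nonneg (by linarith) hk0.le)
  rw [div_le_iff₀ hδ0] at h3
  nlinarith

end Widening

/-! ### One iteration at a node -/

section Node

variable {S A X : Type*}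

/-- The sum of `g` over the children of a node. -/
def Node.childSum {M : Type*} [AddCommMonoid M] (g : A → M) (ν : Node S A) : M :=
  ∑ i, g (ν.child i)

theorem Node.childSum_addChild {M : Type*} [AddCommMonoid M] (g : A → M) (ν : Node S A) (a : A) :
    (ν.addChild a).childSum g = ν.childSum g + g a := by
  change ∑ i : Fin (ν.numChildren + 1), g (Fin.snoc (α := fun _ => A) ν.child a i) = _
  rw [Fin.sum_univ_castSucc]
  simp [Node.childSum]

theorem Node.childSum_setChild {M : Type*} [AddCommMonoid M] (g : A → M) (ν : Node S A)
    (i : Fin ν.numChildren) (a : A) :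
    (ν.setChild i a).childSum g + g (ν.child i) = ν.childSum g + g a := by
  classical
  change ∑ j : Fin ν.numChildren, g (Function.update ν.child i a j) + _ = _
  rw [Node.childSum, ← Finset.add_sum_erase _ _ (Finset.mem_univ i),
    ← Finset.add_sum_erase Finset.univ (fun j => g (ν.child j)) (Finset.mem_univ i),
    Function.update_self]
  have : ∑ j ∈ Finset.univ.erase i, g (Function.update ν.child i a j) =
      ∑ j ∈ Finset.univ.erase i, g (ν.child j) :=
    Finset.sum_congr rfl fun j hj => by rw [Function.update_of_ne (Finset.ne_of_mem_erase hj)]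
  rw [this]
  abel

/-- The product of `g` over the children of a node. -/
noncomputable def Node.childProd (g : A → ℝ≥0∞) (ν : Node S A) : ℝ≥0∞ :=
  ∏ i, g (ν.child i)

theorem Node.childProd_addChild (g : A → ℝ≥0∞) (ν : Node S A) (a : A) :
    (ν.addChild a).childProd g = ν.childProd g * g a := by
  change ∏ i : Fin (ν.numChildren + 1), g (Fin.snoc (α := fun _ => A) ν.child a i) = _
  rw [Fin.prod_univ_castSucc]
  simp [Node.childProd]

theorem Node.exists_childProd_setChild (g : A → ℝ≥0∞) (ν : Node S A) (i : Fin ν.numChildren) :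
    ∃ c, ν.childProd g = c * g (ν.child i) ∧ ∀ a, (ν.setChild i a).childProd g = c * g a := by
  classical
  refine ⟨∏ j ∈ Finset.univ.erase i, g (ν.child j), ?_, fun a => ?_⟩
  · rw [Node.childProd, Finset.prod_erase_mul _ _ (Finset.mem_univ i)]
  · change ∏ j : Fin ν.numChildren, g (Function.update ν.child i a j) = _
    rw [← Finset.prod_erase_mul _ _ (Finset.mem_univ i), Function.update_self]
    congr 1
    exact Finset.prod_congr rfl fun j hj => by
      rw [Function.update_of_ne (Finset.ne_of_mem_erase hj)]

theorem Node.boltzmann_nonneg (lam : ℝ) (v : A → ℝ) (ν : Node S A) (i : Fin ν.numChildren) :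
    0 ≤ ν.boltzmann lam v i := by
  unfold Node.boltzmann; positivity

theorem Node.sum_boltzmann (lam : ℝ) (v : A → ℝ) (ν : Node S A) (hn : ν.numChildren ≠ 0) :
    ∑ i, ν.boltzmann lam v i = 1 := by
  have : Nonempty (Fin ν.numChildren) := ⟨⟨0, Nat.pos_of_ne_zero hn⟩⟩
  simp only [Node.boltzmann, ← Finset.sum_div]
  exact div_self (Finset.sum_pos (fun j _ => Real.exp_pos _) Finset.univ_nonempty).ne'

theorem Node.sum_boltzmann_le (lam : ℝ) (v : A → ℝ) (ν : Node S A) :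
    ∑ i, ν.boltzmann lam v i ≤ 1 := by
  simp only [Node.boltzmann, ← Finset.sum_div]
  exact div_self_le_one _

theorem Node.le_boltzmann {lam B : ℝ} (hlam : 0 < lam) {v : A → ℝ} (hv : ∀ a, |v a| ≤ B)
    (ν : Node S A) (i : Fin ν.numChildren) :
    Real.exp (-(2 * (lam * B))) / ν.numChildren ≤ ν.boltzmann lam v i := by
  have h : ∀ a, |lam * v a| ≤ lam * B := fun a => by
    rw [abs_mul, abs_of_pos hlam]
    exact mul_le_mul_of_nonneg_left (hv a) hlam.le
  have : Nonempty (Fin ν.numChildren) := ⟨i⟩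
  have hpos : 0 < ∑ j, Real.exp (lam * v (ν.child j)) :=
    Finset.sum_pos (fun j _ => Real.exp_pos _) Finset.univ_nonempty
  have hn : (0 : ℝ) < ν.numChildren := by exact_mod_cast Fin.pos i
  have hsum : ∑ j, Real.exp (lam * v (ν.child j)) ≤ ν.numChildren * Real.exp (lam * B) := by
    refine (Finset.sum_le_card_nsmul _ _ _ fun j _ =>
      Real.exp_le_exp.2 (abs_le.1 (h (ν.child j))).2).trans_eq ?_
    simp
  rw [Node.boltzmann, div_le_div_iff₀ hn hpos]
  calc Real.exp (-(2 * (lam * B))) * ∑ j, Real.exp (lam * v (ν.child j))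
      ≤ Real.exp (-(2 * (lam * B))) * (ν.numChildren * Real.exp (lam * B)) :=
        mul_le_mul_of_nonneg_left hsum (Real.exp_pos _).le
    _ = Real.exp (-(lam * B)) * ν.numChildren := by
        rw [mul_left_comm, ← Real.exp_add, mul_comm]
        ring_nf
    _ ≤ Real.exp (lam * v (ν.child i)) * ν.numChildren :=
        mul_le_mul_of_nonneg_right (Real.exp_le_exp.2 (abs_le.1 (h _)).1) hn.le

variable [MeasurableSpace S] [MeasurableSpace A] [MeasurableSpace X]

theorem measurable_index : Measurable fun ν : Node S A => ν.1 :=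
  measurable_of_node fun _ => measurable_const

theorem measurable_visits : Measurable fun ν : Node S A => ν.visits :=
  measurable_fst.comp measurable_index

theorem measurable_numChildren : Measurable fun ν : Node S A => ν.numChildren :=
  measurable_snd.comp measurable_index

theorem measurable_state : Measurable fun ν : Node S A => ν.state :=
  measurable_of_node fun _ => measurable_fst

theorem measurableSet_of_node {p : Node S A → Prop}
    (h : ∀ k : ℕ × ℕ, MeasurableSet {q : S × (Fin k.2 → A) | p ⟨k, q⟩}) :
    MeasurableSet {ν | p ν} :=
  MeasurableSpace.measurableSet_iInf.2 h

theorem measurable_childSum {M : Type*} [AddCommMonoid M] [MeasurableSpace M] [MeasurableAdd₂ M]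
    {g : A → M} (hg : Measurable g) : Measurable fun ν : Node S A => ν.childSum g := by
  refine measurable_of_node fun k => ?_
  have h : Measurable fun p : S × (Fin k.2 → A) => ∑ i, g (p.2 i) :=
    Finset.measurable_sum _ fun i _ => hg.comp ((measurable_pi_apply i).comp measurable_snd)
  exact h

theorem measurable_childProd {g : A → ℝ≥0∞} (hg : Measurable g) :
    Measurable fun ν : Node S A => ν.childProd g := by
  refine measurable_of_node fun k => ?_
  have h : Measurable fun p : S × (Fin k.2 → A) => ∏ i, g (p.2 i) :=
    Finset.measurable_prod _ fun i _ => hg.comp ((measurable_pi_apply i).comp measurable_snd)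
  exact h

theorem measurable_addChild (ν : Node S A) :
    Measurable fun y : A × X => (ν.addChild y.1, y.2) := by
  refine Measurable.prodMk ((measurable_node_mk _).comp ?_) measurable_snd
  refine Measurable.prodMk measurable_const ?_
  exact (measurable_snoc ν.numChildren).comp (f := fun y : A × X => (ν.child, y.1)) (by fun_prop)

theorem measurable_setChild (ν : Node S A) (i : Fin ν.numChildren) :
    Measurable fun y : A × X => (ν.setChild i y.1, y.2) := by
  refine Measurable.prodMk ((measurable_node_mk _).comp ?_) measurable_snd
  refine Measurable.prodMk measurable_const ?_
  exact (measurable_update ν.child).comp measurable_fst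

variable {lam C α : ℝ} {proposal : Kernel S X} [IsMarkovKernel proposal]
  {init : X → A} {hi : Measurable init} {v : A → ℝ} {hv : Measurable v}
  {visit : Kernel A (A × X)} [IsMarkovKernel visit]

theorem lintegral_visitKernel_of_expandable {ν : Node S A} (h : ν.Expandable C α)
    {F : Node S A × X → ℝ≥0∞} (hF : Measurable F) :
    ∫⁻ y, F y ∂visitKernel lam C α proposal hi hv visit ν =
      ∫⁻ x, ∫⁻ y, F (ν.addChild y.1, y.2) ∂visit (init x) ∂proposal ν.state := by
  change ∫⁻ y, F y ∂visitMeasure lam C α proposal init v visit ν = _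
  rw [visitMeasure, if_pos h, lintegral_map hF (measurable_addChild ν),
    Measure.lintegral_bind (m := proposal ν.state) (μ := fun x => visit (init x)) (f := fun y : A × X => F (ν.addChild y.1, y.2))
      ((visit.measurable.comp hi).aemeasurable) (hF.comp (measurable_addChild ν)).aemeasurable]

theorem lintegral_visitKernel_of_not_expandable {ν : Node S A} (h : ¬ν.Expandable C α)
    {F : Node S A × X → ℝ≥0∞} (hF : Measurable F) :
    ∫⁻ y, F y ∂visitKernel lam C α proposal hi hv visit ν =
      ∑ i, ENNReal.ofReal (ν.boltzmann lam v i) *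
        ∫⁻ y, F (ν.setChild i y.1, y.2) ∂visit (ν.child i) := by
  change ∫⁻ y, F y ∂visitMeasure lam C α proposal init v visit ν = _
  rw [visitMeasure, if_neg h, lintegral_finsetSum_measure]
  refine Finset.sum_congr rfl fun i _ => ?_
  rw [lintegral_smul_measure, lintegral_map hF (measurable_setChild ν i), smul_eq_mul]

/-- A property of the outcome of an iteration holds almost surely if it does after an expansion and
after the selection of any child. -/
theorem ae_visitKernel {ν : Node S A} {p : Node S A × X → Prop} (hp : MeasurableSet {y | p y})
    (h₁ : ν.Expandable C α → ∀ x, ∀ᵐ y ∂visit (init x), p (ν.addChild y.1, y.2))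
    (h₂ : ¬ν.Expandable C α → ∀ i, ∀ᵐ y ∂visit (ν.child i), p (ν.setChild i y.1, y.2)) :
    ∀ᵐ y ∂visitKernel lam C α proposal hi hv visit ν, p y := by
  have hF : Measurable ({y | p y}ᶜ.indicator fun _ => (1 : ℝ≥0∞)) :=
    measurable_const.indicator hp.compl
  have h0 : ∫⁻ y, {y | p y}ᶜ.indicator (fun _ => (1 : ℝ≥0∞)) y
      ∂visitKernel lam C α proposal hi hv visit ν = 0 := by
    by_cases h : ν.Expandable C α
    · rw [lintegral_visitKernel_of_expandable h hF]
      refine (lintegral_congr fun x => ?_).trans lintegral_zero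
      rw [lintegral_eq_zero_iff (by exact hF.comp (measurable_addChild ν))]
      filter_upwards [h₁ h x] with y hy
      simp [hy]
    · rw [lintegral_visitKernel_of_not_expandable h hF]
      refine Finset.sum_eq_zero fun i _ => ?_
      rw [(lintegral_eq_zero_iff (by exact hF.comp (measurable_setChild ν i))).2, mul_zero]
      filter_upwards [h₂ h i] with y hy
      simp [hy]
  rw [lintegral_eq_zero_iff hF] at h0
  filter_upwards [h0] with y hy
  by_contra hc
  simp [hc] at hy

/-- Visit count, number of children and state of a node evolve deterministically. -/
theorem ae_index_state [MeasurableSingletonClass S] (s : S) :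
    ∀ᵐ ω ∂chain (visitKernel lam C α proposal hi hv visit) (Node.new s),
      ∀ k, (stateAt (Node.new s) ω k).visits = k + 1 ∧
        (stateAt (Node.new s) ω k).numChildren = childCount C α k ∧
        (stateAt (Node.new s) ω k).state = s := by
  let p : Node S A → Node S A → Prop := fun ν ν' => ν'.visits = ν.visits + 1 ∧
    (ν.Expandable C α → ν'.numChildren = ν.numChildren + 1) ∧
    (¬ν.Expandable C α → ν'.numChildren = ν.numChildren)
  have hE : MeasurableSet {ν : Node S A | ν.Expandable C α} :=
    measurable_index (MeasurableSet.of_discrete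
      (s := {k : ℕ × ℕ | k.2 = 0 ∨ (k.2 : ℝ) < C * (k.1 : ℝ) ^ α}))
  have hp : MeasurableSet {q : Node S A × (Node S A × X) | p q.1 q.2.1} := by
    have hm : Measurable fun q : Node S A × (Node S A × X) => (q.1.1, q.2.1.1) :=
      (measurable_index.comp measurable_fst).prodMk
        (measurable_index.comp (measurable_fst.comp measurable_snd))
    exact hm (MeasurableSet.of_discrete (s := {k : (ℕ × ℕ) × ℕ × ℕ | k.2.1 = k.1.1 + 1 ∧
      ((k.1.2 = 0 ∨ (k.1.2 : ℝ) < C * (k.1.1 : ℝ) ^ α) → k.2.2 = k.1.2 + 1) ∧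
      (¬(k.1.2 = 0 ∨ (k.1.2 : ℝ) < C * (k.1.1 : ℝ) ^ α) → k.2.2 = k.1.2)}))
  have h1 := ae_chain_of_forall_ae (visitKernel lam C α proposal hi hv visit) (Node.new s)
    (R := fun ν y => p ν y.1) hp fun ν => ae_visitKernel
      (measurable_prodMk_left (x := ν) hp)
      (fun h x => ae_of_all _ fun y => ⟨rfl, fun _ => rfl, fun h' => absurd h h'⟩)
      (fun h i => ae_of_all _ fun y => ⟨rfl, fun h' => absurd h' h, fun _ => rfl⟩)
  have hst : MeasurableSet {ν : Node S A | ν.state = s} :=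
    measurable_state (measurableSet_singleton s)
  have h2 := ae_chain_of_invariant (visitKernel lam C α proposal hi hv visit) (Node.new s)
    (I := fun ν => ν.state = s) hst rfl fun ν hν => ae_visitKernel
      (measurable_fst hst)
      (fun h x => ae_of_all _ fun y => hν) (fun h i => ae_of_all _ fun y => hν)
  filter_upwards [h1, h2] with ω h1 h2 k
  have hvis : ∀ k, (stateAt (Node.new s) ω k).visits = k + 1 := fun k => by
    induction k with
    | zero => rfl
    | succ k ih => exact (h1 k).1.trans (congrArg (· + 1) ih)
  refine ⟨hvis k, ?_, h2 k⟩
  · induction k with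
    | zero => rfl
    | succ k ih =>
      obtain ⟨-, ha, hb⟩ := h1 k
      rw [Node.Expandable, ih, hvis k] at ha hb
      by_cases h : childCount C α k = 0 ∨ (childCount C α k : ℝ) < C * ((k + 1 : ℕ) : ℝ) ^ α
      · rw [childCount_succ_of_expandable h]; exact ha h
      · rw [childCount_succ_of_not_expandable h]; exact hb h

end Node

/-! ### Averages over the children of a node -/

section Average

variable {S A X : Type*} [MeasurableSpace S] [MeasurableSpace A] [MeasurableSpace X]
  {lam C α : ℝ} {proposal : Kernel S X} [IsMarkovKernel proposal]
  {init : X → A} {hi : Measurable init} {v : A → ℝ} {hv : Measurable v}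
  {visit : Kernel A (A × X)} [IsMarkovKernel visit]

/-- An expansion multiplies the expected product over the children by at most the mean of `g` at a
new child, if `g` is superharmonic for the iterations below a child. -/
theorem lintegral_childProd_le_of_expandable {g : A → ℝ≥0∞} (hg : Measurable g)
    (hsup : ∀ a, ∫⁻ y, g y.1 ∂visit a ≤ g a) {ν : Node S A} (h : ν.Expandable C α) {ρ : ℝ≥0∞}
    (hρ : ∫⁻ x, g (init x) ∂proposal ν.state ≤ ρ) :
    ∫⁻ y, y.1.childProd g ∂visitKernel lam C α proposal hi hv visit ν ≤ ρ * ν.childProd g := by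
  rw [lintegral_visitKernel_of_expandable h (by exact (measurable_childProd hg).comp measurable_fst)]
  simp only [Node.childProd_addChild]
  calc ∫⁻ x, ∫⁻ y, ν.childProd g * g y.1 ∂visit (init x) ∂proposal ν.state
      ≤ ∫⁻ x, ν.childProd g * g (init x) ∂proposal ν.state := by
        refine lintegral_mono fun x => ?_
        rw [lintegral_const_mul _ (by exact hg.comp measurable_fst)]
        exact mul_le_mul_right (hsup _) _
    _ = ν.childProd g * ∫⁻ x, g (init x) ∂proposal ν.state :=
        lintegral_const_mul _ (hg.comp hi)
    _ ≤ ρ * ν.childProd g := by rw [mul_comm]; exact mul_le_mul_left hρ _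

theorem lintegral_childProd_le_of_not_expandable {g : A → ℝ≥0∞} (hg : Measurable g)
    (hsup : ∀ a, ∫⁻ y, g y.1 ∂visit a ≤ g a) {ν : Node S A} (h : ¬ν.Expandable C α) :
    ∫⁻ y, y.1.childProd g ∂visitKernel lam C α proposal hi hv visit ν ≤ ν.childProd g := by
  have hn : ν.numChildren ≠ 0 := fun h' => h (Or.inl h')
  rw [lintegral_visitKernel_of_not_expandable h
    (by exact (measurable_childProd hg).comp measurable_fst)]
  calc ∑ i, ENNReal.ofReal (ν.boltzmann lam v i) *
        ∫⁻ y, (ν.setChild i y.1).childProd g ∂visit (ν.child i)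
      ≤ ∑ i, ENNReal.ofReal (ν.boltzmann lam v i) * ν.childProd g := by
        refine Finset.sum_le_sum fun i _ => mul_le_mul_right ?_ _
        obtain ⟨c, hc, hc'⟩ := ν.exists_childProd_setChild g i
        simp only [hc', hc]
        rw [lintegral_const_mul _ (by exact hg.comp measurable_fst)]
        exact mul_le_mul_right (hsup _) _
    _ = ν.childProd g := by
        rw [← Finset.sum_mul, ← ENNReal.ofReal_sum_of_nonneg fun i _ => ν.boltzmann_nonneg lam v i,
          ν.sum_boltzmann lam v hn, ENNReal.ofReal_one, one_mul]

theorem lintegral_childProd_stateAt_le [MeasurableSingletonClass S] {g : A → ℝ≥0∞}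
    (hg : Measurable g) (hsup : ∀ a, ∫⁻ y, g y.1 ∂visit a ≤ g a) {s : S} {ρ : ℝ≥0∞}
    (hρ : ∫⁻ x, g (init x) ∂proposal s ≤ ρ) (k : ℕ) :
    ∫⁻ ω, (stateAt (Node.new s) ω k).childProd g
      ∂chain (visitKernel lam C α proposal hi hv visit) (Node.new s) ≤ ρ ^ childCount C α k := by
  induction k with
  | zero =>
    have : ∀ ω, (stateAt (Node.new s : Node S A) ω 0 : Node S A).childProd g = 1 :=
      fun ω : ℕ → Node S A × X => Finset.prod_empty
    simp [this, childCount]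
  | succ k ih =>
    have hstep := lintegral_chain_step (visitKernel lam C α proposal hi hv visit)
      (Node.new s) k (G := fun _ => 1) measurable_const (fun _ _ _ => rfl)
      (F := fun _ y => y.1.childProd g)
      ((measurable_childProd hg).comp (measurable_fst.comp measurable_snd))
    simp only [one_mul] at hstep
    refine hstep.trans_le ?_
    have hm : Measurable fun ω : ℕ → Node S A × X => (stateAt (Node.new s) ω k).childProd g :=
      (measurable_childProd hg).comp (measurable_stateAt _ k)
    have hdet := ae_index_state (lam := lam) (C := C) (α := α) (proposal := proposal) (hi := hi)
      (hv := hv) (visit := visit) s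
    by_cases h : childCount C α k = 0 ∨ (childCount C α k : ℝ) < C * ((k + 1 : ℕ) : ℝ) ^ α
    · rw [childCount_succ_of_expandable h, pow_succ, mul_comm]
      refine le_trans ?_ (mul_le_mul_right ih ρ)
      rw [← lintegral_const_mul _ hm]
      refine lintegral_mono_ae ?_
      filter_upwards [hdet] with ω hω
      obtain ⟨h1, h2, h3⟩ := hω k
      refine lintegral_childProd_le_of_expandable hg hsup ?_ (by rw [h3]; exact hρ)
      rw [Node.Expandable, h1, h2]
      exact h
    · rw [childCount_succ_of_not_expandable h]
      refine le_trans (lintegral_mono_ae ?_) ih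
      filter_upwards [hdet] with ω hω
      obtain ⟨h1, h2, h3⟩ := hω k
      refine lintegral_childProd_le_of_not_expandable hg hsup ?_
      rw [Node.Expandable, h1, h2]
      exact h

theorem exp_mul_le_one_add {θ x : ℝ} (h0 : 0 ≤ x) (h1 : x ≤ 1) :
    Real.exp (θ * x) ≤ 1 + (Real.exp θ - 1) * x := by
  have := rpow_one_add_le_one_add_mul_self (s := Real.exp θ - 1)
    (by linarith [Real.exp_pos θ]) h0 h1
  rw [add_sub_cancel, ← Real.exp_mul] at this
  linarith

/-- If `h` is superharmonic for the iterations below a child, then the children's average of `h` is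
asymptotically at most the mean of `h` at a new child. The reason is that the children evolve
without interaction, so that `∏ (1 + c * h)` over the children is a supermartingale up to a factor
for each new child; this yields an exponential bound in the number of children. -/
theorem ae_eventually_childSum_le [MeasurableSingletonClass S] (hC : 0 < C)
    (hα : α ∈ Set.Ioo (0 : ℝ) 1) {h : A → ℝ≥0∞} (hm : Measurable h) (h1 : ∀ a, h a ≤ 1)
    (hsup : ∀ a, ∫⁻ y, h y.1 ∂visit a ≤ h a) {s : S} {m : ℝ} (hm0 : 0 ≤ m)
    (hinit : ∫⁻ x, h (init x) ∂proposal s ≤ ENNReal.ofReal m) {δ : ℝ} (hδ : 0 < δ) :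
    ∀ᵐ ω ∂chain (visitKernel lam C α proposal hi hv visit) (Node.new s), ∀ᶠ k in atTop,
      (stateAt (Node.new s) ω k).childSum (fun a => (h a).toReal) ≤
        (m + δ) * childCount C α k := by
  -- With `c = exp θ - 1 ≤ θ + θ ^ 2` the Chernoff exponent `θ * (m + δ) - c * m` is at least
  -- `θ * δ / 2`.
  obtain ⟨θ, hθ, hθ1, hθδ⟩ : ∃ θ : ℝ, 0 < θ ∧ θ ≤ 1 ∧ θ * m ≤ δ / 2 := by
    refine ⟨min 1 (δ / 2 / (m + 1)), by positivity, min_le_left _ _, ?_⟩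
    refine (mul_le_mul_of_nonneg_right (min_le_right _ _) hm0).trans ?_
    rw [div_mul_eq_mul_div, div_le_iff₀ (by positivity)]
    nlinarith
  set c : ℝ := Real.exp θ - 1 with hc
  have hc0 : 0 < c := by
    have := Real.add_one_le_exp θ
    linarith
  have hcθ : c ≤ θ + θ ^ 2 := by
    have := (abs_le.1 (Real.abs_exp_sub_one_sub_id_le (x := θ) (by rw [abs_of_pos hθ]; exact hθ1))).2
    linarith
  let g : A → ℝ≥0∞ := fun a => 1 + ENNReal.ofReal c * h a
  have hg : Measurable g := (hm.const_mul _).const_add _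
  have hgsup : ∀ a, ∫⁻ y, g y.1 ∂visit a ≤ g a := fun a => by
    have hm' : Measurable fun y : A × X => h y.1 := hm.comp measurable_fst
    simp only [g]
    rw [lintegral_add_left measurable_const, lintegral_const, measure_univ, mul_one,
      lintegral_const_mul _ hm']
    exact add_le_add_right (mul_le_mul_right (hsup a) _) _
  have hρ : ∫⁻ x, g (init x) ∂proposal s ≤ ENNReal.ofReal (Real.exp (c * m)) := by
    have hm' : Measurable fun x => h (init x) := hm.comp hi
    simp only [g]
    rw [lintegral_add_left measurable_const, lintegral_const, measure_univ, mul_one,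
      lintegral_const_mul _ hm']
    refine (add_le_add_right (mul_le_mul_right hinit _) _).trans ?_
    rw [← ENNReal.ofReal_mul hc0.le, ← ENNReal.ofReal_one,
      ← ENNReal.ofReal_add zero_le_one (by positivity)]
    refine ENNReal.ofReal_le_ofReal ?_
    linarith [Real.add_one_le_exp (c * m)]
  let Z : ℕ → (ℕ → Node S A × X) → ℝ≥0∞ := fun k ω =>
    ENNReal.ofReal (Real.exp (-(θ * (m + δ) * childCount C α k))) *
      (stateAt (Node.new s) ω k).childProd g
  have hZm : ∀ k, Measurable fun ω : ℕ → Node S A × X => (stateAt (Node.new s) ω k).childProd g :=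
    fun k => (measurable_childProd hg).comp (measurable_stateAt _ k)
  have hZ : ∀ k, ∫⁻ ω, Z k ω ∂chain (visitKernel lam C α proposal hi hv visit) (Node.new s) ≤
      ENNReal.ofReal (Real.exp (-(θ * δ / 2 * childCount C α k))) := fun k => by
    simp only [Z]
    rw [lintegral_const_mul _ (hZm k)]
    refine (mul_le_mul_right (lintegral_childProd_stateAt_le hg hgsup hρ k) _).trans ?_
    rw [← ENNReal.ofReal_pow (Real.exp_pos _).le, ← ENNReal.ofReal_mul (Real.exp_pos _).le,
      ← Real.exp_nat_mul, ← Real.exp_add]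
    refine ENNReal.ofReal_le_ofReal (Real.exp_le_exp.2 ?_)
    have h3 : c * m ≤ θ * m + θ * (δ / 2) := by nlinarith
    have h4 : 0 ≤ (childCount C α k : ℝ) := Nat.cast_nonneg _
    nlinarith
  have hsum : ∑' k, ∫⁻ ω, Z k ω ∂chain (visitKernel lam C α proposal hi hv visit) (Node.new s)
      ≠ ∞ :=
    ne_top_of_le_ne_top (summable_exp_neg_childCount hC hα (c := θ * δ / 2)
      (by positivity)).tsum_ofReal_ne_top (ENNReal.tsum_le_tsum hZ)
  filter_upwards [ae_eventually_lt_one_of_tsum_lintegral_ne_top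
    (fun k => (hZm k).const_mul _) hsum] with ω hω
  filter_upwards [hω] with k hk
  set ν := stateAt (Node.new s) ω k
  have h5 : ENNReal.ofReal (Real.exp (θ * ν.childSum (fun a => (h a).toReal))) ≤
      ν.childProd g := by
    rw [Node.childSum, Finset.mul_sum, Real.exp_sum,
      ENNReal.ofReal_prod_of_nonneg fun i _ => (Real.exp_pos _).le, Node.childProd]
    refine Finset.prod_le_prod' fun i _ => ?_
    have htop : h (ν.child i) ≠ ∞ := ne_top_of_le_ne_top ENNReal.one_ne_top (h1 _)
    refine (ENNReal.ofReal_le_ofReal (exp_mul_le_one_add ENNReal.toReal_nonneg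
      (ENNReal.toReal_le_of_le_ofReal zero_le_one (by simpa using h1 (ν.child i))))).trans_eq ?_
    rw [ENNReal.ofReal_add zero_le_one (by positivity), ENNReal.ofReal_one,
      ENNReal.ofReal_mul hc0.le, ENNReal.ofReal_toReal htop]
  have h6 := (mul_le_mul_right h5 _).trans_lt hk
  rw [← ENNReal.ofReal_mul (Real.exp_pos _).le, ← Real.exp_add, ENNReal.ofReal_lt_one,
    Real.exp_lt_one_iff] at h6
  have h7 : θ * ν.childSum (fun a => (h a).toReal) < θ * ((m + δ) * childCount C α k) := by
    linarith
  exact (lt_of_mul_lt_mul_left h7 hθ.le).le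

/-- Every child is visited often: if `β` counts the visits that a child still needs, then the
proportion of children that still need a visit tends to zero. Indeed, a needy child is selected with
a probability of the order of this proportion, and all needs together amount to at most `J` visits
per child, a vanishing fraction of all iterations. -/
theorem ae_tendsto_childSum_pos_div [MeasurableSingletonClass S] (hC : 0 < C)
    (hα : α ∈ Set.Ioo (0 : ℝ) 1) (hlam : 0 < lam) {B : ℝ} (hvB : ∀ a, |v a| ≤ B) {β : A → ℕ}
    (hβ : Measurable β) {J : ℕ} (hβJ : ∀ a, β a ≤ J)
    (hdrop : ∀ a, ∀ᵐ y ∂visit a, β y.1 ≤ β a - 1) (s : S) :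
    ∀ᵐ ω ∂chain (visitKernel lam C α proposal hi hv visit) (Node.new s),
      Tendsto (fun k => (stateAt (Node.new s) ω k).childSum
        (fun a => if β a = 0 then (0 : ℝ) else 1) / childCount C α k) atTop (𝓝 0) := by
  set K := visitKernel lam C α proposal hi hv visit with hK
  set low : A → ℝ := fun a => if β a = 0 then (0 : ℝ) else 1 with hlow
  have hlowm : Measurable low :=
    Measurable.ite (hβ (measurableSet_singleton 0)) measurable_const measurable_const
  have hlow0 : ∀ a, 0 ≤ low a := fun a => by simp only [hlow]; split_ifs <;> norm_num
  have hlow1 : ∀ a, low a ≤ 1 := fun a => by simp only [hlow]; split_ifs <;> norm_num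
  -- `E` is the event that the iteration lowers the total need.
  let E : Set (Node S A × (Node S A × X)) := {q | q.2.1.childSum β + 1 ≤ q.1.childSum β}
  have hE : MeasurableSet E := measurableSet_le
    (((measurable_childSum hβ).comp (measurable_fst.comp measurable_snd)).add_const 1)
    ((measurable_childSum hβ).comp measurable_fst)
  let F : Node S A → Node S A × X → ℝ := fun ν y => E.indicator (fun _ => (1 : ℝ)) (ν, y)
  have hF : Measurable (Function.uncurry F) := measurable_const.indicator hE
  have hF0 : ∀ ν y, 0 ≤ F ν y := fun ν y => Set.indicator_nonneg (fun _ _ => zero_le_one) _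
  have hF1 : ∀ ν y, F ν y ≤ 1 := fun ν y => Set.indicator_le_self' (fun _ _ => zero_le_one) _
  have hlln := tendsto_average_sub_condExp K (Node.new s) hF (K := 1)
    fun ν y => by rw [abs_of_nonneg (hF0 ν y)]; exact hF1 ν y
  -- The total need and the number of needy children are controlled move by move.
  have hmove : ∀ ν, ∀ᵐ y ∂K ν, F ν y + y.1.childSum β ≤
      ν.childSum β + J * ((y.1.numChildren : ℝ) - ν.numChildren) ∧
      y.1.childSum low ≤ ν.childSum low + ((y.1.numChildren : ℝ) - ν.numChildren) := fun ν => by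
    have hFν : Measurable (F ν) := hF.comp measurable_prodMk_left
    have hnum : Measurable fun y : Node S A × X => (y.1.numChildren : ℝ) :=
      measurable_from_top.comp (measurable_numChildren.comp measurable_fst)
    have hβs : Measurable fun y : Node S A × X => ((y.1.childSum β : ℕ) : ℝ) :=
      measurable_from_top.comp ((measurable_childSum hβ).comp measurable_fst)
    refine ae_visitKernel (MeasurableSet.inter (measurableSet_le (hFν.add hβs) ?_)
      (measurableSet_le ((measurable_childSum hlowm).comp measurable_fst) ?_)) ?_ ?_
    · exact ((hnum.sub_const _).const_mul _).const_add _
    · exact (hnum.sub_const _).const_add _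
    · intro h x
      filter_upwards with y
      have hn : (((ν.addChild y.1).numChildren : ℕ) : ℝ) = ν.numChildren + 1 := by
        exact_mod_cast rfl
      simp only [Node.childSum_addChild, hn]
      have hF' : F ν (ν.addChild y.1, y.2) = 0 := by
        refine Set.indicator_of_notMem (fun hmem => ?_) _
        have h' : (ν.addChild y.1).childSum β + 1 ≤ ν.childSum β := hmem
        rw [Node.childSum_addChild] at h'
        omega
      have h2 : (β y.1 : ℝ) ≤ J := by exact_mod_cast hβJ y.1
      rw [hF']
      push_cast
      exact ⟨by linarith, by linarith [hlow1 y.1]⟩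
    · intro h i
      filter_upwards [hdrop (ν.child i)] with y hy
      have hn : (((ν.setChild i y.1).numChildren : ℕ) : ℝ) = ν.numChildren := rfl
      have h1 := ν.childSum_setChild β i y.1
      have h2 := ν.childSum_setChild low i y.1
      have h3 : low y.1 ≤ low (ν.child i) := by
        by_cases h0 : β (ν.child i) = 0
        · have : β y.1 = 0 := by omega
          simp [hlow, this, h0]
        · simp only [hlow, if_neg h0]
          split_ifs <;> norm_num
      simp only [hn, sub_self, mul_zero, add_zero]
      refine ⟨?_, by linarith⟩
      by_cases hmem : (ν, (ν.setChild i y.1, y.2)) ∈ E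
      · have h' : (ν.setChild i y.1).childSum β + 1 ≤ ν.childSum β := hmem
        simp only [F, Set.indicator_of_mem hmem]
        rw [add_comm]
        exact_mod_cast h'
      · simp only [F, Set.indicator_of_notMem hmem, zero_add]
        have : (ν.setChild i y.1).childSum β ≤ ν.childSum β := by omega
        exact_mod_cast this
  have hmove' := ae_chain_of_forall_ae K (Node.new s) (R := fun ν y => F ν y + y.1.childSum β ≤
      ν.childSum β + J * ((y.1.numChildren : ℝ) - ν.numChildren) ∧
      y.1.childSum low ≤ ν.childSum low + ((y.1.numChildren : ℝ) - ν.numChildren)) (by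
    have hnum : Measurable fun ν : Node S A => (ν.numChildren : ℝ) :=
      measurable_from_top.comp measurable_numChildren
    have hβs : Measurable fun ν : Node S A => ((ν.childSum β : ℕ) : ℝ) :=
      measurable_from_top.comp (measurable_childSum hβ)
    have hls : Measurable fun ν : Node S A => ν.childSum low := measurable_childSum hlowm
    have h21 : Measurable fun q : Node S A × (Node S A × X) => q.2.1 :=
      measurable_fst.comp measurable_snd
    have hd : Measurable fun q : Node S A × (Node S A × X) =>
        (q.2.1.numChildren : ℝ) - q.1.numChildren :=
      (hnum.comp h21).sub (hnum.comp measurable_fst)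
    exact (measurableSet_le (hF.add (hβs.comp h21))
      ((hβs.comp measurable_fst).add (hd.const_mul _))).inter
      (measurableSet_le (hls.comp h21) ((hls.comp measurable_fst).add hd))) hmove
  set c : ℝ := Real.exp (-(2 * (lam * B))) with hc
  have hc0 : 0 < c := Real.exp_pos _
  -- A needy child is selected with a probability that is at least `c / n`.
  have hsel : ∀ ν : Node S A, ¬ν.Expandable C α →
      c * (ν.childSum low / ν.numChildren) ≤ ∫ y, F ν y ∂K ν := fun ν hν => by
    have hFν : Measurable (F ν) := hF.comp measurable_prodMk_left
    rw [integral_eq_lintegral_of_nonneg_ae (ae_of_all _ (hF0 ν)) hFν.aestronglyMeasurable]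
    have hfin : ∫⁻ y, ENNReal.ofReal (F ν y) ∂K ν ≠ ∞ := by
      refine ne_top_of_le_ne_top ENNReal.one_ne_top
        ((lintegral_mono (g := fun _ => 1) fun y => ?_).trans_eq (by simp))
      exact (ENNReal.ofReal_le_ofReal (hF1 ν y)).trans_eq ENNReal.ofReal_one
    refine (ENNReal.ofReal_le_iff_le_toReal hfin).1 ?_
    rw [lintegral_visitKernel_of_not_expandable hν hFν.ennreal_ofReal]
    calc ENNReal.ofReal (c * (ν.childSum low / ν.numChildren))
        = ENNReal.ofReal (∑ i, c / ν.numChildren * low (ν.child i)) := by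
          rw [← Finset.mul_sum, Node.childSum]; congr 1; ring
      _ ≤ ENNReal.ofReal (∑ i, ν.boltzmann lam v i * low (ν.child i)) :=
          ENNReal.ofReal_le_ofReal (Finset.sum_le_sum fun i _ =>
            mul_le_mul_of_nonneg_right (Node.le_boltzmann hlam hvB ν i) (hlow0 _))
      _ = ∑ i, ENNReal.ofReal (ν.boltzmann lam v i) * ENNReal.ofReal (low (ν.child i)) := by
          rw [ENNReal.ofReal_sum_of_nonneg fun i _ =>
            mul_nonneg (ν.boltzmann_nonneg lam v i) (hlow0 _)]
          exact Finset.sum_congr rfl fun i _ => ENNReal.ofReal_mul (ν.boltzmann_nonneg lam v i)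
      _ ≤ _ := by
          refine Finset.sum_le_sum fun i _ => mul_le_mul_right ?_ _
          by_cases h0 : β (ν.child i) = 0
          · simp [hlow, h0]
          · have h1 : ∀ᵐ y ∂visit (ν.child i),
                (1 : ℝ≥0∞) ≤ ENNReal.ofReal (F ν (ν.setChild i y.1, y.2)) := by
              filter_upwards [hdrop (ν.child i)] with y hy
              have hmem : (ν, (ν.setChild i y.1, y.2)) ∈ E := by
                have := ν.childSum_setChild β i y.1
                change (ν.setChild i y.1).childSum β + 1 ≤ ν.childSum β
                omega
              simp only [F, Set.indicator_of_mem hmem, ENNReal.ofReal_one, le_refl]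
            refine le_trans ?_ (lintegral_mono_ae h1)
            simp [hlow, h0]
  filter_upwards [hlln, hmove', ae_index_state (lam := lam) (C := C) (α := α)
    (proposal := proposal) (hi := hi) (hv := hv) (visit := visit) s] with ω hlln hmove hdet
  set Y := stateAt (Node.new s) ω with hY
  have hnum : ∀ k, (Y k).numChildren = childCount C α k := fun k => (hdet k).2.1
  have hL0 : ∀ k, 0 ≤ (Y k).childSum low := fun k => Finset.sum_nonneg fun i _ => hlow0 _
  refine tendsto_div_childCount_of_cesaro hC hα hL0 (fun m k hmk => ?_) ?_
  · induction k, hmk using Nat.le_induction with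
    | base => simp
    | succ k _ ih =>
      have h1 := (hmove k).2
      change (Y (k + 1)).childSum low ≤ (Y k).childSum low +
        ((Y (k + 1)).numChildren - (Y k).numChildren) at h1
      rw [hnum, hnum] at h1
      linarith
  · -- Each iteration in the event `E` uses up one of the at most `J` visits granted per child.
    have hsumF : ∀ k : ℕ, ∑ m ∈ Finset.range k, F (Y m) (ω m) ≤ J * childCount C α k := by
      have : ∀ k : ℕ, ∑ m ∈ Finset.range k, F (Y m) (ω m) + (Y k).childSum β ≤
          J * childCount C α k := fun k => by
        induction k with
        | zero =>
          have : (Y 0).childSum β = 0 := Finset.sum_empty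
          simp [this, childCount]
        | succ k ih =>
          have h1 := (hmove k).1
          change F (Y k) (ω k) + (Y (k + 1)).childSum β ≤ (Y k).childSum β +
            J * ((Y (k + 1)).numChildren - (Y k).numChildren) at h1
          rw [hnum, hnum] at h1
          rw [Finset.sum_range_succ]
          linarith
      exact fun k => le_trans (le_add_of_nonneg_right (Nat.cast_nonneg _)) (this k)
    have hn := tendsto_childCount_div hC hα
    have hF' : Tendsto (fun k : ℕ => (∑ m ∈ Finset.range k, F (Y m) (ω m)) / k) atTop (𝓝 0) := by
      have h2 := hn.const_mul (J : ℝ)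
      rw [mul_zero] at h2
      refine squeeze_zero (fun k => div_nonneg (Finset.sum_nonneg fun m _ => hF0 _ _)
        (Nat.cast_nonneg k)) (fun k => ?_) h2
      rw [← mul_div_assoc]
      exact div_le_div_of_nonneg_right (hsumF k) (Nat.cast_nonneg k)
    have hI : Tendsto (fun k : ℕ => (∑ m ∈ Finset.range k, ∫ y, F (Y m) y ∂K (Y m)) / k)
        atTop (𝓝 0) := by
      have h3 := hF'.sub hlln
      rw [sub_zero] at h3
      refine h3.congr fun k => ?_
      rw [Finset.sum_sub_distrib]
      ring
    have hlim := (hI.const_mul c⁻¹).add hn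
    rw [mul_zero, add_zero] at hlim
    refine squeeze_zero (fun k => div_nonneg (Finset.sum_nonneg fun m _ =>
      div_nonneg (hL0 m) (Nat.cast_nonneg _)) (Nat.cast_nonneg k)) (fun k => ?_) hlim
    rw [← mul_div_assoc, ← add_div, Finset.mul_sum]
    refine div_le_div_of_nonneg_right ?_ (Nat.cast_nonneg k)
    have hstep : ∀ m, (Y m).childSum low / childCount C α m ≤
        c⁻¹ * ∫ y, F (Y m) y ∂K (Y m) + (childCount C α (m + 1) - childCount C α m) := fun m => by
      have hint : 0 ≤ ∫ y, F (Y m) y ∂K (Y m) := integral_nonneg (hF0 _)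
      by_cases h : childCount C α m = 0 ∨ (childCount C α m : ℝ) < C * ((m + 1 : ℕ) : ℝ) ^ α
      · rw [childCount_succ_of_expandable h]
        have h4 : (Y m).childSum low / childCount C α m ≤ 1 := by
          refine div_le_one_of_le₀ ?_ (Nat.cast_nonneg _)
          rw [← hnum m]
          refine (Finset.sum_le_card_nsmul _ _ 1 fun i _ => hlow1 _).trans_eq ?_
          simp
        have : 0 ≤ c⁻¹ * ∫ y, F (Y m) y ∂K (Y m) := by positivity
        push_cast
        linarith
      · rw [childCount_succ_of_not_expandable h, sub_self, add_zero]
        have h5 := hsel (Y m) (by rw [Node.Expandable, (hdet m).1, hnum]; exact h)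
        rw [hnum] at h5
        rwa [← div_eq_inv_mul, le_div_iff₀ hc0, mul_comm]
    calc ∑ m ∈ Finset.range k, (Y m).childSum low / childCount C α m
        ≤ ∑ m ∈ Finset.range k, (c⁻¹ * ∫ y, F (Y m) y ∂K (Y m) +
          ((childCount C α (m + 1) : ℝ) - childCount C α m)) :=
          Finset.sum_le_sum fun m _ => hstep m
      _ = _ := by
          rw [Finset.sum_add_distrib, Finset.sum_range_sub fun m => (childCount C α m : ℝ)]
          simp [childCount]

end Average

/-! ### Convergence at a node and control of the error -/

section Control

/-- The error `d` is under control for newborn subtrees `init x`, `x ∼ μ`: up to a bounded number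
`β` of visits that the subtree still needs, `d` is dominated by a function `h` that is superharmonic
for the iterations of the subtree and has a small mean at birth. For a Markov chain this is a
formulation by means of one-step expectations of the almost sure convergence of `d` to zero; unlike
the latter, it can be summed over the children of a node, which are visited at times that depend on
their evolution. -/
def ControlledError {A X : Type*} [MeasurableSpace A] [MeasurableSpace X]
    (visit : Kernel A (A × X)) (μ : Measure X) (init : X → A) (d : A → ℝ≥0∞) : Prop :=
  ∀ ε : ℝ, 0 < ε → ∃ (h : A → ℝ≥0∞) (β : A → ℕ) (J : ℕ),
    Measurable h ∧ (∀ a, h a ≤ 1) ∧ (∀ a, ∫⁻ y, h y.1 ∂visit a ≤ h a) ∧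
    Measurable β ∧ (∀ a, β a ≤ J) ∧ (∀ a, ∀ᵐ y ∂visit a, β y.1 ≤ β a - 1) ∧
    (∀ a, β a = 0 → d a ≤ h a) ∧ ∫⁻ x, h (init x) ∂μ ≤ ENNReal.ofReal ε

/-- Almost sure convergence along the chain gives control of the error: the superharmonic function
is the Snell envelope of the error after at least `J` visits. -/
theorem controlledError_of_tendsto {A X : Type*} [MeasurableSpace A] [MeasurableSpace X]
    {visit : Kernel A (A × X)} [IsMarkovKernel visit] {μ : Measure X} [IsProbabilityMeasure μ]
    {init : X → A} (hi : Measurable init) {d : A → ℝ≥0∞} (hd : Measurable d) (hd1 : ∀ a, d a ≤ 1)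
    {vis : A → ℕ} (hvis : Measurable vis) (hvisit : ∀ a, ∀ᵐ y ∂visit a, vis y.1 = vis a + 1)
    (h : ∀ x, ∀ᵐ ω ∂chain visit (init x), Tendsto (fun k => d (stateAt (init x) ω k)) atTop (𝓝 0)) :
    ControlledError visit μ init d := by
  let dJ : ℕ → A → ℝ≥0∞ := fun J => {a | J ≤ vis a}.indicator d
  have hset : ∀ J, MeasurableSet {a | J ≤ vis a} := fun J =>
    measurableSet_le measurable_const hvis
  have hdJ : ∀ J, Measurable (dJ J) := fun J => hd.indicator (hset J)
  have hdJ1 : ∀ J a, dJ J a ≤ 1 := fun J a => (Set.indicator_le_self _ _ _).trans (hd1 a)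
  have hvischain : ∀ x, ∀ᵐ ω ∂chain visit (init x), ∀ k,
      vis (stateAt (init x) ω k) = vis (init x) + k := fun x => by
    filter_upwards [ae_chain_of_forall_ae visit (init x) (R := fun a y => vis y.1 = vis a + 1)
      (measurableSet_eq_fun (hvis.comp (measurable_fst.comp measurable_snd))
        ((hvis.comp measurable_fst).add_const 1)) hvisit] with ω hω k
    induction k with
    | zero => rfl
    | succ k ih => exact (hω k).trans (by rw [ih, add_assoc])
  have hpt : ∀ x, Tendsto (fun J => snell visit (dJ J) (init x)) atTop (𝓝 0) := fun x => by
    have hlim : Tendsto (fun J => ∫⁻ ω, ⨆ k, dJ J (stateAt (init x) ω k) ∂chain visit (init x))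
        atTop (𝓝 (∫⁻ _, 0 ∂chain visit (init x))) := by
      refine tendsto_lintegral_of_dominated_convergence (fun _ => 1)
        (fun J => Measurable.iSup fun k => (hdJ J).comp (measurable_stateAt _ k))
        (fun J => ae_of_all _ fun ω => iSup_le fun k => hdJ1 J _) (by simp) ?_
      filter_upwards [h x, hvischain x] with ω hω hv
      refine ENNReal.tendsto_nhds_zero.2 fun ε hε => ?_
      obtain ⟨k₀, hk₀⟩ := eventually_atTop.1 (ENNReal.tendsto_nhds_zero.1 hω ε hε)
      filter_upwards [eventually_ge_atTop (vis (init x) + k₀)] with J hJ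
      refine iSup_le fun k => ?_
      by_cases hk : stateAt (init x) ω k ∈ {a | J ≤ vis a}
      · simp only [dJ, Set.indicator_of_mem hk]
        have hk' : J ≤ vis (stateAt (init x) ω k) := hk
        rw [hv] at hk'
        exact hk₀ k (by omega)
      · simp only [dJ, Set.indicator_of_notMem hk, zero_le]
    rw [lintegral_zero] at hlim
    exact tendsto_of_tendsto_of_tendsto_of_le_of_le tendsto_const_nhds hlim (fun _ => zero_le)
      fun J => snell_le_lintegral_iSup (hdJ J) (init x)
  have hint : Tendsto (fun J => ∫⁻ x, snell visit (dJ J) (init x) ∂μ) atTop (𝓝 (∫⁻ _, 0 ∂μ)) :=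
    tendsto_lintegral_of_dominated_convergence (fun _ => 1)
      (fun J => (measurable_snell (hdJ J)).comp hi)
      (fun J => ae_of_all _ fun x => snell_le (hdJ1 J) _) (by simp)
      (ae_of_all _ hpt)
  rw [lintegral_zero] at hint
  intro ε hε
  obtain ⟨J, hJ⟩ := (ENNReal.tendsto_nhds_zero.1 hint (ENNReal.ofReal ε)
    (ENNReal.ofReal_pos.2 hε)).exists
  refine ⟨snell visit (dJ J), fun a => J - vis a, J, measurable_snell (hdJ J), snell_le (hdJ1 J),
    lintegral_snell_le (hdJ J), measurable_from_top.comp hvis, fun a => Nat.sub_le _ _,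
    fun a => ?_, fun a ha => ?_, hJ⟩
  · filter_upwards [hvisit a] with y hy
    omega
  · have hmem : a ∈ {a | J ≤ vis a} := Nat.sub_eq_zero_iff_le.1 ha
    refine le_trans (le_of_eq ?_) (le_snell a)
    simp only [dJ, Set.indicator_of_mem hmem]

variable {S A X : Type*} [MeasurableSpace S] [MeasurableSpace A] [MeasurableSpace X]
  {lam C α : ℝ} {proposal : Kernel S X} [IsMarkovKernel proposal]
  {init : X → A} {hi : Measurable init} {v : A → ℝ} {hv : Measurable v}
  {visit : Kernel A (A × X)} [IsMarkovKernel visit]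

/-- A conserved quantity is superharmonic, so its average over the children is at most its mean at
a new child, asymptotically. -/
theorem ae_eventually_childSum_le_of_conserved [MeasurableSingletonClass S] (hC : 0 < C)
    (hα : α ∈ Set.Ioo (0 : ℝ) 1) {g : A → ℝ} (hg : Measurable g) (hg0 : ∀ a, 0 ≤ g a)
    (hg1 : ∀ a, g a ≤ 1) (hcons : ∀ a, ∀ᵐ y ∂visit a, g y.1 = g a) (s : S) {δ : ℝ} (hδ : 0 < δ) :
    ∀ᵐ ω ∂chain (visitKernel lam C α proposal hi hv visit) (Node.new s), ∀ᶠ k in atTop,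
      (stateAt (Node.new s) ω k).childSum g ≤
        (∫ x, g (init x) ∂proposal s + δ) * childCount C α k := by
  have hint : Integrable (fun x => g (init x)) (proposal s) :=
    Integrable.of_bound (hg.comp hi).aestronglyMeasurable 1 (ae_of_all _ fun x => by
      rw [Real.norm_of_nonneg (hg0 _)]; exact hg1 _)
  have := ae_eventually_childSum_le (lam := lam) (proposal := proposal) (hi := hi) (hv := hv)
    (visit := visit) hC hα (h := fun a => ENNReal.ofReal (g a)) hg.ennreal_ofReal
    (fun a => by rw [← ENNReal.ofReal_one]; exact ENNReal.ofReal_le_ofReal (hg1 a))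
    (fun a => by
      refine (lintegral_congr_ae (g := fun _ => ENNReal.ofReal (g a)) ?_).trans_le (by simp)
      filter_upwards [hcons a] with y hy
      rw [hy]) (s := s)
    (m := ∫ x, g (init x) ∂proposal s) (integral_nonneg fun x => hg0 _)
    (ofReal_integral_eq_lintegral_ofReal hint (ae_of_all _ fun x => hg0 _)).ge hδ
  simpa only [ENNReal.toReal_ofReal (hg0 _)] using this

/-- If the error made by `φ` in estimating the conserved quantity `φ'` is under control, then the
average of `φ` over the children of a node converges to the mean of `φ'` at a new child. -/
theorem ae_tendsto_childSum_div [MeasurableSingletonClass S] (hC : 0 < C)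
    (hα : α ∈ Set.Ioo (0 : ℝ) 1) (hlam : 0 < lam) {B : ℝ} (hvB : ∀ a, |v a| ≤ B)
    {φ φ' : A → ℝ} (hφ' : Measurable φ')
    (hφ'1 : ∀ a, |φ' a| ≤ 1 / 2) (hcons : ∀ a, ∀ᵐ y ∂visit a, φ' y.1 = φ' a) (s : S)
    (herr : ControlledError visit (proposal s) init fun a => ENNReal.ofReal |φ a - φ' a|)
    (herr1 : ∀ a, |φ a - φ' a| ≤ 1) :
    ∀ᵐ ω ∂chain (visitKernel lam C α proposal hi hv visit) (Node.new s),
      Tendsto (fun k => (stateAt (Node.new s) ω k).childSum φ / childCount C α k) atTop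
        (𝓝 (∫ x, φ' (init x) ∂proposal s)) := by
  set E := ∫ x, φ' (init x) ∂proposal s with hE
  have hint : Integrable (fun x => φ' (init x)) (proposal s) :=
    Integrable.of_bound (hφ'.comp hi).aestronglyMeasurable (1 / 2) (ae_of_all _ fun x => hφ'1 _)
  have key : ∀ n : ℕ, ∀ᵐ ω ∂chain (visitKernel lam C α proposal hi hv visit) (Node.new s),
      ∀ᶠ k in atTop, |(stateAt (Node.new s) ω k).childSum φ - E * childCount C α k| ≤
        4 * (1 / ((n : ℝ) + 1)) * childCount C α k := fun n => by
    set δ : ℝ := 1 / ((n : ℝ) + 1) with hδ'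
    have hδ : 0 < δ := by positivity
    obtain ⟨h, β, J, hm, h1, hsup, hβ, hβJ, hdrop, hle, hinit⟩ := herr δ hδ
    -- The shifts by `1 / 2` make `φ'` and `-φ'` nonnegative. The error is at most `δ` for the mean of
    -- `φ'`, `2 * δ` for the superharmonic bound and `δ` for the children that need more visits.
    have hA₁ := ae_eventually_childSum_le_of_conserved (lam := lam) (proposal := proposal)
      (hi := hi) (hv := hv) (visit := visit) hC hα (g := fun a => φ' a + 1 / 2)
      (hφ'.add_const _) (fun a => by linarith [(abs_le.1 (hφ'1 a)).1])
      (fun a => by linarith [(abs_le.1 (hφ'1 a)).2])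
      (fun a => by filter_upwards [hcons a] with y hy; rw [hy]) s hδ
    have hA₂ := ae_eventually_childSum_le_of_conserved (lam := lam) (proposal := proposal)
      (hi := hi) (hv := hv) (visit := visit) hC hα (g := fun a => 1 / 2 - φ' a)
      (hφ'.const_sub _) (fun a => by linarith [(abs_le.1 (hφ'1 a)).2])
      (fun a => by linarith [(abs_le.1 (hφ'1 a)).1])
      (fun a => by filter_upwards [hcons a] with y hy; rw [hy]) s hδ
    have hB := ae_eventually_childSum_le (lam := lam) (proposal := proposal) (hi := hi) (hv := hv)
      (visit := visit) hC hα hm h1 hsup hδ.le hinit hδ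
    have hL := ae_tendsto_childSum_pos_div (proposal := proposal) (hi := hi) (hv := hv)
      (visit := visit) hC hα hlam hvB hβ hβJ hdrop s
    rw [integral_add hint (integrable_const _)] at hA₁
    rw [integral_sub (integrable_const _) hint] at hA₂
    simp only [integral_const, probReal_univ, smul_eq_mul, one_mul] at hA₁ hA₂
    filter_upwards [hA₁, hA₂, hB, hL, ae_index_state (lam := lam) (C := C) (α := α)
      (proposal := proposal) (hi := hi) (hv := hv) (visit := visit) s] with ω hA₁ hA₂ hB hL hdet
    filter_upwards [hA₁, hA₂, hB, hL.eventually_le_const hδ, eventually_gt_atTop 0]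
      with k hA₁ hA₂ hB hL hk
    obtain ⟨k, rfl⟩ := Nat.exists_eq_succ_of_ne_zero hk.ne'
    have hnum := (hdet (k + 1)).2.1
    set ν := stateAt (Node.new s) ω (k + 1)
    have hn : (0 : ℝ) < childCount C α (k + 1) := by exact_mod_cast childCount_pos k
    rw [div_le_iff₀ hn] at hL
    simp only [Node.childSum, Finset.sum_add_distrib, Finset.sum_sub_distrib, Finset.sum_const,
      Finset.card_univ, Fintype.card_fin, nsmul_eq_mul, hnum] at hA₁ hA₂
    change ∑ i, φ' (ν.child i) + _ ≤ _ at hA₁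
    change _ - ∑ i, φ' (ν.child i) ≤ _ at hA₂
    have hdiff : |∑ i, φ (ν.child i) - ∑ i, φ' (ν.child i)| ≤ ν.childSum (fun a => (h a).toReal) +
        ν.childSum (fun a => if β a = 0 then (0 : ℝ) else 1) := by
      rw [← Finset.sum_sub_distrib, Node.childSum, Node.childSum, ← Finset.sum_add_distrib]
      refine (Finset.abs_sum_le_sum_abs _ _).trans (Finset.sum_le_sum fun i _ => ?_)
      by_cases h0 : β (ν.child i) = 0
      · rw [if_pos h0, add_zero]
        exact (ENNReal.ofReal_le_iff_le_toReal
          (ne_top_of_le_ne_top ENNReal.one_ne_top (h1 _))).1 (hle _ h0)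
      · rw [if_neg h0]
        exact (herr1 _).trans (le_add_of_nonneg_left ENNReal.toReal_nonneg)
    have hdiff' := abs_le.1 hdiff
    change |∑ i, φ (ν.child i) - _| ≤ _
    exact abs_le.2 ⟨by linarith [hdiff'.1], by linarith [hdiff'.2]⟩
  filter_upwards [ae_all_iff.2 key] with ω hω
  rw [Metric.tendsto_atTop']
  intro ε hε
  obtain ⟨n, hn⟩ := exists_nat_one_div_lt (show 0 < ε / 4 by positivity)
  obtain ⟨k₀, hk₀⟩ := eventually_atTop.1 (hω n)
  refine ⟨k₀, fun k hk => ?_⟩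
  have h1 := hk₀ k hk.le
  obtain ⟨k, rfl⟩ := Nat.exists_eq_succ_of_ne_zero ((Nat.zero_le _).trans_lt hk).ne'
  have hpos : (0 : ℝ) < childCount C α (k + 1) := by exact_mod_cast childCount_pos k
  rw [Real.dist_eq, div_sub' hpos.ne', abs_div, abs_of_pos hpos, div_lt_iff₀ hpos,
    mul_comm (childCount C α (k + 1) : ℝ) E]
  exact h1.trans_lt (mul_lt_mul_of_pos_right (by linarith) hpos)

end Control

/-! ### Iterated averages over a subtree -/

section Subtree

variable {X : Type*}

/-- The iterated average of `φ` over a subtree: at a terminal node the value of `φ`, elsewhere the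
average of the iterated averages of the children. -/
noncomputable def treeAverage (φ : X → ℝ) : ∀ t, Subtree X t → ℝ
  | 0 => φ
  | t + 1 => fun ν => Node.childSum (treeAverage φ t) ν / Node.numChildren ν

/-- The state at the top of a subtree. -/
def topState : ∀ t, Subtree X t → X
  | 0 => fun x => x
  | _ + 1 => fun ν => Node.state ν

theorem topState_newSubtree (t : ℕ) (x : X) : topState t (newSubtree t x) = x := by
  cases t <;> rfl

theorem abs_childSum_div_le {S A : Type*} {g : A → ℝ} {K : ℝ} (hK0 : 0 ≤ K)
    (hK : ∀ a, |g a| ≤ K) (ν : Node S A) : |ν.childSum g / ν.numChildren| ≤ K := by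
  rw [abs_div, Nat.abs_cast]
  refine div_le_of_le_mul₀ (Nat.cast_nonneg _) hK0 ?_
  refine (Finset.abs_sum_le_sum_abs _ _).trans ((Finset.sum_le_card_nsmul _ _ K
    fun i _ => hK _).trans_eq ?_)
  simp [mul_comm]

theorem abs_treeAverage_le {φ : X → ℝ} {K : ℝ} (hK0 : 0 ≤ K) (hφ : ∀ x, |φ x| ≤ K) :
    ∀ t a, |treeAverage φ t a| ≤ K
  | 0 => hφ
  | t + 1 => abs_childSum_div_le hK0 (abs_treeAverage_le hK0 hφ t)

theorem treeAverage_const_mul (c : ℝ) (φ : X → ℝ) :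
    ∀ t a, treeAverage (fun x => c * φ x) t a = c * treeAverage φ t a
  | 0 => fun _ => rfl
  | t + 1 => fun ν => by
    simp only [treeAverage, Node.childSum, treeAverage_const_mul c φ t, ← Finset.mul_sum,
      mul_div_assoc]

variable [MeasurableSpace X]

theorem measurable_treeAverage {φ : X → ℝ} (hφ : Measurable φ) :
    ∀ t, Measurable (treeAverage φ t)
  | 0 => hφ
  | t + 1 => (measurable_childSum (measurable_treeAverage hφ t)).div
      (measurable_from_top.comp measurable_numChildren)

theorem measurable_topState : ∀ t, Measurable (topState t : Subtree X t → X)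
  | 0 => measurable_id
  | _ + 1 => measurable_state

namespace Setup

variable (D : Setup X)

instance isMarkovKernel_terminalKernel : ∀ t, IsMarkovKernel (D.terminalKernel t)
  | 0 => inferInstanceAs (IsMarkovKernel Kernel.id)
  | t + 1 =>
    haveI := isMarkovKernel_terminalKernel t
    inferInstanceAs (IsMarkovKernel (D.terminalKernel t ∘ₖ D.kernel t))

/-- The mean of `φ` at the terminal state under the base model started at time `t`. -/
noncomputable def terminalMean (φ : X → ℝ) (t : ℕ) (x : X) : ℝ := ∫ y, φ y ∂D.terminalKernel t x

theorem measurable_terminalMean {φ : X → ℝ} (hφ : Measurable φ) (t : ℕ) :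
    Measurable (D.terminalMean φ t) :=
  (StronglyMeasurable.integral_kernel_prod_right'
    (hφ.comp measurable_snd).stronglyMeasurable).measurable

theorem abs_terminalMean_le {φ : X → ℝ} {K : ℝ} (hφ : ∀ x, |φ x| ≤ K) (t : ℕ) (x : X) :
    |D.terminalMean φ t x| ≤ K := by
  have := norm_integral_le_of_norm_le_const (μ := D.terminalKernel t x) (f := φ) (ae_of_all _ hφ)
  simpa [terminalMean] using this

theorem terminalMean_zero {φ : X → ℝ} (hφ : Measurable φ) (x : X) : D.terminalMean φ 0 x = φ x := by
  change ∫ y, φ y ∂Kernel.id x = _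
  rw [Kernel.id_apply, integral_dirac' _ _ hφ.stronglyMeasurable]

theorem terminalMean_succ {φ : X → ℝ} (hφ : Measurable φ) {K : ℝ} (hK : ∀ x, |φ x| ≤ K) (t : ℕ)
    (x : X) : D.terminalMean φ (t + 1) x = ∫ y, D.terminalMean φ t y ∂D.kernel t x :=
  Kernel.integral_comp (Integrable.of_bound hφ.aestronglyMeasurable K (ae_of_all _ hK))

theorem integral_base {φ : X → ℝ} (hφ : Measurable φ) {K : ℝ} (hK : ∀ x, |φ x| ≤ K) :
    ∫ x, φ x ∂D.base = ∫ x, D.terminalMean φ D.T x ∂D.prior := by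
  exact Kernel.integral_comp (κ := Kernel.const Unit D.prior) (a := ()) (η := D.terminalKernel D.T)
    (Integrable.of_bound hφ.aestronglyMeasurable K (ae_of_all _ hK))

/-- The value estimates are bounded like the reward. At a node without children the backup is
`1 / lam * log 0 = 0`, which is within the bounds as well. -/
theorem abs_value_le {B : ℝ} (hB0 : 0 ≤ B) (hB : ∀ x, |D.reward x| ≤ B) (hlam : 0 < D.lam) :
    ∀ t a, |D.value t a| ≤ B
  | 0 => hB
  | t + 1 => fun ν => by
    have ih := abs_value_le hB0 hB hlam t
    change |1 / D.lam * Real.log (1 / (Node.numChildren ν : ℝ) *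
      ∑ i, Real.exp (D.lam * D.value t (Node.child ν i)))| ≤ B
    by_cases hn : Node.numChildren ν = 0
    · simpa [hn] using hB0
    have hn' : (0 : ℝ) < Node.numChildren ν := by exact_mod_cast Nat.pos_of_ne_zero hn
    have h : ∀ a, |D.lam * D.value t a| ≤ D.lam * B := fun a => by
      rw [abs_mul, abs_of_pos hlam]
      exact mul_le_mul_of_nonneg_left (ih a) hlam.le
    have hup : ∑ i, Real.exp (D.lam * D.value t (Node.child ν i)) ≤
        Node.numChildren ν * Real.exp (D.lam * B) :=
      (Finset.sum_le_card_nsmul _ _ _ fun j _ => Real.exp_le_exp.2 (abs_le.1 (h _)).2).trans_eq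
        (by simp)
    have hlow : Node.numChildren ν * Real.exp (-(D.lam * B)) ≤
        ∑ i, Real.exp (D.lam * D.value t (Node.child ν i)) :=
      (by simp : _ = _).trans_le
        (Finset.card_nsmul_le_sum _ _ _ fun j _ => Real.exp_le_exp.2 (abs_le.1 (h _)).1)
    rw [abs_mul, abs_of_pos (one_div_pos.2 hlam), one_div, inv_mul_le_iff₀ hlam]
    rw [one_div, ← div_eq_inv_mul]
    have hpos : 0 < (∑ i, Real.exp (D.lam * D.value t (Node.child ν i))) / Node.numChildren ν :=
      div_pos ((mul_pos hn' (Real.exp_pos _)).trans_le hlow) hn'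
    refine abs_le.2 ⟨?_, ?_⟩
    · rw [Real.le_log_iff_exp_le hpos, le_div_iff₀ hn', mul_comm]
      exact hlow
    · rw [Real.log_le_iff_le_exp hpos, div_le_iff₀ hn', mul_comm]
      exact hup

theorem visit_zero_apply (x : Subtree X 0) :
    D.visit 0 x = Measure.dirac ((x, x) : Subtree X 0 × X) :=
  Kernel.deterministic_apply (f := fun x : X => (x, x)) (by fun_prop) x

theorem visit_succ (t : ℕ) : D.visit (t + 1) = visitKernel D.lam D.C D.α (D.kernel t)
    (measurable_newSubtree t) (D.measurable_value t) (D.visit t) := rfl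

theorem ae_topState_visit [MeasurableSingletonClass X] :
    ∀ (t : ℕ) (a : Subtree X t), ∀ᵐ y ∂D.visit t a, topState t y.1 = topState t a
  | 0 => fun a => by
    rw [visit_zero_apply, ae_dirac_iff]
    exact (measurable_topState 0).comp measurable_fst (measurableSet_singleton (topState 0 a))
  | t + 1 => fun ν => by
    rw [visit_succ]
    exact ae_visitKernel ((measurable_topState (t + 1)).comp measurable_fst
      (measurableSet_singleton (Node.state ν)))
      (fun _ _ => ae_of_all _ fun _ => rfl) (fun _ _ => ae_of_all _ fun _ => rfl)

theorem ae_visits_visit (t : ℕ) (ν : Subtree X (t + 1)) :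
    ∀ᵐ y ∂D.visit (t + 1) ν, Node.visits y.1 = Node.visits ν + 1 := by
  rw [visit_succ]
  exact ae_visitKernel (measurable_visits.comp measurable_fst
    (measurableSet_singleton (Node.visits ν + 1)))
    (fun _ _ => ae_of_all _ fun _ => rfl) (fun _ _ => ae_of_all _ fun _ => rfl)

/-- Within a subtree of any height, the iterated averages converge to the mean under the base model.
The induction over the height alternates between the convergence at a node and the control of the
error at its parent. -/
theorem controlledError_treeAverage [MeasurableSingletonClass X] (hlam : 0 < D.lam) (hC : 0 < D.C)
    (hα : D.α ∈ Set.Ioo (0 : ℝ) 1) {B : ℝ} (hB0 : 0 ≤ B) (hB : ∀ x, |D.reward x| ≤ B)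
    {φ : X → ℝ} (hφ : Measurable φ) (hφ1 : ∀ x, |φ x| ≤ 1 / 2) :
    ∀ (t : ℕ) (μ : Measure X), IsProbabilityMeasure μ →
      ControlledError (D.visit t) μ (newSubtree t) fun a =>
        ENNReal.ofReal |treeAverage φ t a - D.terminalMean φ t (topState t a)|
  | 0 => fun μ _ ε hε => by
    refine ⟨fun _ => 0, fun _ => 0, 0, measurable_const, fun _ => zero_le, fun _ => by simp,
      measurable_const, fun _ => le_rfl, fun a => ae_of_all _ fun _ => le_rfl, fun a _ => ?_,
      by simp⟩
    have h : treeAverage φ 0 a = D.terminalMean φ 0 (topState 0 a) :=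
      (D.terminalMean_zero hφ a).symm
    simp [h]
  | t + 1 => fun μ hμ => by
    have hle : ∀ t a, |treeAverage φ t a - D.terminalMean φ t (topState t a)| ≤ 1 := fun t a => by
      have h1 := abs_le.1 (abs_treeAverage_le (by norm_num) hφ1 t a)
      have h2 := abs_le.1 (D.abs_terminalMean_le hφ1 t (topState t a))
      exact abs_le.2 ⟨by linarith, by linarith⟩
    have hmean : ∀ t, Measurable fun a => D.terminalMean φ t (topState t a) := fun t =>
      (D.measurable_terminalMean hφ t).comp (measurable_topState t)
    refine controlledError_of_tendsto (measurable_newSubtree (t + 1))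
      (((measurable_treeAverage hφ (t + 1)).sub (hmean (t + 1))).abs.ennreal_ofReal)
      (fun a => ?_) (vis := fun ν => Node.visits ν) measurable_visits (D.ae_visits_visit t)
      fun x => ?_
    · rw [← ENNReal.ofReal_one]
      exact ENNReal.ofReal_le_ofReal (hle (t + 1) a)
    · have hconv := ae_tendsto_childSum_div (lam := D.lam) (C := D.C) (α := D.α)
        (proposal := D.kernel t) (hi := measurable_newSubtree t) (hv := D.measurable_value t)
        (visit := D.visit t) hC hα hlam (D.abs_value_le hB0 hB hlam t)
        (φ := treeAverage φ t) (hmean t) (fun a => D.abs_terminalMean_le hφ1 t _)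
        (fun a => by filter_upwards [D.ae_topState_visit t a] with y hy; rw [hy]) x
        (controlledError_treeAverage hlam hC hα hB0 hB hφ hφ1 t (D.kernel t x) inferInstance)
        (hle t)
      simp only [topState_newSubtree] at hconv
      rw [← D.terminalMean_succ hφ hφ1] at hconv
      filter_upwards [hconv, ae_index_state (lam := D.lam) (C := D.C) (α := D.α)
        (proposal := D.kernel t) (hi := measurable_newSubtree t) (hv := D.measurable_value t)
        (visit := D.visit t) x] with ω hω hdet
      have h1 : ∀ k, treeAverage φ (t + 1) (stateAt (newSubtree (t + 1) x) ω k) -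
          D.terminalMean φ (t + 1) (topState (t + 1) (stateAt (newSubtree (t + 1) x) ω k)) =
          (stateAt (Node.new x) ω k).childSum (treeAverage φ t) / childCount D.C D.α k -
          D.terminalMean φ (t + 1) x := fun k => by
        rw [← (hdet k).2.1]
        exact congrArg (fun z => _ - D.terminalMean φ (t + 1) z) (hdet k).2.2
      simp only [h1]
      have h2 := (hω.sub_const (D.terminalMean φ (t + 1) x)).abs
      rw [sub_self, abs_zero] at h2
      rw [← ENNReal.ofReal_zero]
      exact ENNReal.tendsto_ofReal h2

/-- The iterated average over the whole tree converges to the mean under the base model. It is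
written with the quotient at the root because the root, which has no state, is not a `Subtree`. -/
theorem ae_tendsto_rootAverage [MeasurableSingletonClass X] (hlam : 0 < D.lam) (hC : 0 < D.C)
    (hα : D.α ∈ Set.Ioo (0 : ℝ) 1) {B : ℝ} (hB : ∀ x, |D.reward x| ≤ B)
    {φ : X → ℝ} (hφ : Measurable φ) {K : ℝ} (hK : ∀ x, |φ x| ≤ K) :
    ∀ᵐ ω ∂D.run, Tendsto (fun k => (stateAt (rootTree X D.T) ω k).childSum
      (treeAverage φ D.T) / (stateAt (rootTree X D.T) ω k).numChildren) atTop
      (𝓝 (∫ x, φ x ∂D.base)) := by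
  obtain ⟨x₀⟩ := D.prior.nonempty_of_neZero
  have hB0 : 0 ≤ B := (abs_nonneg _).trans (hB x₀)
  have hK0 : 0 ≤ K := (abs_nonneg _).trans (hK x₀)
  -- Scaling brings `φ` into the range `[-1 / 2, 1 / 2]`.
  set c : ℝ := 1 / (2 * (K + 1)) with hc
  have hc0 : 0 < c := by positivity
  set ψ : X → ℝ := fun x => c * φ x with hψ'
  have hψ : Measurable ψ := hφ.const_mul c
  have hψ1 : ∀ x, |ψ x| ≤ 1 / 2 := fun x => by
    rw [hψ', abs_mul, abs_of_pos hc0]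
    refine (mul_le_mul_of_nonneg_left (hK x) hc0.le).trans ?_
    rw [hc, div_mul_eq_mul_div, div_le_div_iff₀ (by positivity) (by norm_num)]
    linarith
  have hle : ∀ a, |treeAverage ψ D.T a - D.terminalMean ψ D.T (topState D.T a)| ≤ 1 := fun a => by
    have h1 := abs_le.1 (abs_treeAverage_le (by norm_num) hψ1 D.T a)
    have h2 := abs_le.1 (D.abs_terminalMean_le hψ1 D.T (topState D.T a))
    exact abs_le.2 ⟨by linarith, by linarith⟩
  have hconv := ae_tendsto_childSum_div (lam := D.lam) (C := D.C) (α := D.α)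
    (proposal := Kernel.const Unit D.prior) (hi := measurable_newSubtree D.T)
    (hv := D.measurable_value D.T)
    (visit := D.visit D.T) hC hα hlam (D.abs_value_le hB0 hB hlam D.T)
    (φ := treeAverage ψ D.T)
    ((D.measurable_terminalMean hψ D.T).comp (measurable_topState D.T))
    (fun a => D.abs_terminalMean_le hψ1 D.T _)
    (fun a => by
      filter_upwards [D.ae_topState_visit D.T a] with y hy
      exact congrArg (D.terminalMean ψ D.T) hy) ()
    (D.controlledError_treeAverage hlam hC hα hB0 hB hψ hψ1 D.T _ inferInstance) hle
  have hlim : ∫ x, (D.terminalMean ψ D.T ∘ topState D.T) (newSubtree D.T x)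
      ∂Kernel.const Unit D.prior () = c * ∫ x, φ x ∂D.base := by
    simp only [Function.comp_apply, topState_newSubtree, Kernel.const_apply]
    rw [← D.integral_base hψ hψ1, integral_const_mul]
  rw [hlim] at hconv
  filter_upwards [hconv, ae_index_state (lam := D.lam) (C := D.C) (α := D.α)
    (proposal := Kernel.const Unit D.prior) (hi := measurable_newSubtree D.T)
    (hv := D.measurable_value D.T) (visit := D.visit D.T) ()] with ω hω hdet
  have h1 := hω.const_mul c⁻¹
  rw [inv_mul_cancel_left₀ hc0.ne'] at h1
  refine h1.congr fun k => ?_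
  have h2 : (stateAt (rootTree X D.T) ω k).childSum (treeAverage ψ D.T) =
      c * (stateAt (rootTree X D.T) ω k).childSum (treeAverage φ D.T) := by
    simp only [Node.childSum, hψ', treeAverage_const_mul, Finset.mul_sum]
  change c⁻¹ * ((stateAt (rootTree X D.T) ω k).childSum (treeAverage ψ D.T) / _) = _
  rw [h2, ← (hdet k).2.1, mul_div_assoc, inv_mul_cancel_left₀ hc0.ne']
  rfl

end Setup

end Subtree

/-! ### Sampling by selection steps -/

section Sampling

variable {S A X : Type*}

theorem Node.exp_mul_backup {lam : ℝ} (hlam : 0 < lam) (v : A → ℝ) {ν : Node S A}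
    (hn : ν.numChildren ≠ 0) : Real.exp (lam * ν.backup lam v) =
      ν.childSum (fun a => Real.exp (lam * v a)) / ν.numChildren := by
  have : Nonempty (Fin ν.numChildren) := ⟨⟨0, Nat.pos_of_ne_zero hn⟩⟩
  have hpos : 0 < ∑ j, Real.exp (lam * v (ν.child j)) :=
    Finset.sum_pos (fun j _ => Real.exp_pos _) Finset.univ_nonempty
  have hn' : (0 : ℝ) < ν.numChildren := by exact_mod_cast Nat.pos_of_ne_zero hn
  rw [Node.backup, ← mul_assoc, mul_one_div_cancel hlam.ne', one_mul, Real.exp_log (by positivity),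
    one_div, ← div_eq_inv_mul]
  rfl

theorem Node.childSum_eq_mul_sum_boltzmann {lam : ℝ} (v : A → ℝ) {ν : Node S A}
    (hn : ν.numChildren ≠ 0) (I : A → ℝ) :
    ν.childSum (fun a => Real.exp (lam * v a) * I a) =
      ν.childSum (fun a => Real.exp (lam * v a)) * ∑ i, ν.boltzmann lam v i * I (ν.child i) := by
  have : Nonempty (Fin ν.numChildren) := ⟨⟨0, Nat.pos_of_ne_zero hn⟩⟩
  have hpos : 0 < ∑ j, Real.exp (lam * v (ν.child j)) :=
    Finset.sum_pos (fun j _ => Real.exp_pos _) Finset.univ_nonempty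
  rw [Node.childSum, Finset.mul_sum]
  refine Finset.sum_congr rfl fun i _ => ?_
  rw [Node.boltzmann, Node.childSum, ← mul_assoc, mul_div_cancel₀ _ hpos.ne']

/-- The number of expansions that took place at a node and below it, if `e` counts those below the
children. -/
def Node.expansions (e : A → ℕ) (ν : Node S A) : ℕ := ν.numChildren + ν.childSum e

theorem Node.expansions_setChild (e : A → ℕ) (ν : Node S A) (i : Fin ν.numChildren) (a : A) :
    (ν.setChild i a).expansions e + e (ν.child i) = ν.expansions e + e a := by
  have h1 := ν.childSum_setChild e i a
  change ν.numChildren + (ν.setChild i a).childSum e + _ = ν.numChildren + _ + _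
  omega

theorem Node.expansions_addChild (e : A → ℕ) (ν : Node S A) (a : A) :
    (ν.addChild a).expansions e = ν.expansions e + 1 + e a := by
  change ν.numChildren + 1 + (ν.addChild a).childSum e = ν.numChildren + _ + _ + _
  rw [Node.childSum_addChild]
  omega

variable [MeasurableSpace X]

theorem Node.sample_univ_le (lam : ℝ) (v : A → ℝ) {sample : A → Measure X}
    (h : ∀ a, sample a Set.univ ≤ 1) (ν : Node S A) : ν.sample lam v sample Set.univ ≤ 1 := by
  simp only [Node.sample, Measure.finsetSum_apply, Measure.smul_apply, smul_eq_mul]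
  calc ∑ i, ENNReal.ofReal (ν.boltzmann lam v i) * sample (ν.child i) Set.univ
      ≤ ∑ i, ENNReal.ofReal (ν.boltzmann lam v i) :=
        Finset.sum_le_sum fun i _ => mul_le_of_le_one_right' (h _)
    _ = ENNReal.ofReal (∑ i, ν.boltzmann lam v i) :=
        (ENNReal.ofReal_sum_of_nonneg fun i _ => ν.boltzmann_nonneg lam v i).symm
    _ ≤ 1 := by
        rw [← ENNReal.ofReal_one]
        exact ENNReal.ofReal_le_ofReal (ν.sum_boltzmann_le lam v)

theorem Node.integral_sample (lam : ℝ) (v : A → ℝ) {sample : A → Measure X}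
    (h : ∀ a, sample a Set.univ ≤ 1) {f : X → ℝ} (hf : Measurable f) {K : ℝ} (hK : ∀ x, |f x| ≤ K)
    (ν : Node S A) : ∫ x, f x ∂ν.sample lam v sample =
      ∑ i, ν.boltzmann lam v i * ∫ x, f x ∂sample (ν.child i) := by
  have hint : ∀ a, Integrable f (sample a) := fun a => by
    have : IsFiniteMeasure (sample a) := ⟨(h a).trans_lt ENNReal.one_lt_top⟩
    exact Integrable.of_bound hf.aestronglyMeasurable K (ae_of_all _ hK)
  rw [Node.sample, integral_finsetSum_measure fun i _ =>
    (hint _).smul_measure ENNReal.ofReal_ne_top]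
  refine Finset.sum_congr rfl fun i _ => ?_
  rw [integral_smul_measure, ENNReal.toReal_ofReal (ν.boltzmann_nonneg lam v i), smul_eq_mul]

variable [MeasurableSpace S] [MeasurableSpace A]
  {lam C α : ℝ} {proposal : Kernel S X} [IsMarkovKernel proposal]
  {init : X → A} {hi : Measurable init} {v : A → ℝ} {hv : Measurable v}
  {visit : Kernel A (A × X)} [IsMarkovKernel visit]

theorem integral_visitKernel_of_not_expandable {ν : Node S A} (h : ¬ν.Expandable C α)
    {F : Node S A × X → ℝ} (hF : Measurable F) {K : ℝ} (hK : ∀ y, |F y| ≤ K) :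
    ∫ y, F y ∂visitKernel lam C α proposal hi hv visit ν =
      ∑ i, ν.boltzmann lam v i * ∫ y, F (ν.setChild i y.1, y.2) ∂visit (ν.child i) := by
  change ∫ y, F y ∂visitMeasure lam C α proposal init v visit ν = _
  have hint : ∀ i, Integrable F
      ((visit (ν.child i)).map fun y => (ν.setChild i y.1, y.2)) := fun i => by
    have := Measure.isProbabilityMeasure_map (μ := visit (ν.child i))
      (measurable_setChild (X := X) ν i).aemeasurable
    exact Integrable.of_bound hF.aestronglyMeasurable K (ae_of_all _ hK)
  rw [visitMeasure, if_neg h, integral_finsetSum_measure fun i _ =>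
    (hint i).smul_measure ENNReal.ofReal_ne_top]
  refine Finset.sum_congr rfl fun i _ => ?_
  rw [integral_smul_measure, integral_map (measurable_setChild ν i).aemeasurable
    hF.aestronglyMeasurable, ENNReal.toReal_ofReal (ν.boltzmann_nonneg lam v i), smul_eq_mul]

theorem measurable_expansions {e : A → ℕ} (he : Measurable e) :
    Measurable fun ν : Node S A => ν.expansions e :=
  measurable_numChildren.add (measurable_childSum he)

theorem ae_expansions_le {e : A → ℕ} (he : Measurable e)
    (hmono : ∀ a, ∀ᵐ y ∂visit a, e a ≤ e y.1) (ν : Node S A) :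
    ∀ᵐ y ∂visitKernel lam C α proposal hi hv visit ν, ν.expansions e ≤ y.1.expansions e := by
  refine ae_visitKernel (measurableSet_le measurable_const
    ((measurable_expansions he).comp measurable_fst)) (fun _ x => ae_of_all _ fun y => ?_)
    (fun _ i => ?_)
  · rw [Node.expansions_addChild]; omega
  · filter_upwards [hmono (ν.child i)] with y hy
    have := ν.expansions_setChild e i y.1
    omega

/-- The terminal state of an iteration has nearly the law obtained by selection steps alone: the two
differ only when the iteration expands some node. -/
theorem abs_integral_visitKernel_sub_le {e : A → ℕ} (he : Measurable e) {sample : A → Measure X}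
    (hsample : ∀ a, sample a Set.univ ≤ 1) {f : X → ℝ} (hf : Measurable f) (hf1 : ∀ x, |f x| ≤ 1)
    (h : ∀ a, |∫ y, f y.2 ∂visit a - ∫ x, f x ∂sample a| ≤
      2 * (visit a).real {y | e a + 1 ≤ e y.1}) (ν : Node S A) :
    |∫ y, f y.2 ∂visitKernel lam C α proposal hi hv visit ν - ∫ x, f x ∂ν.sample lam v sample| ≤
      2 * (visitKernel lam C α proposal hi hv visit ν).real
        {y | ν.expansions e + 1 ≤ y.1.expansions e} := by
  have hset : MeasurableSet {y : Node S A × X | ν.expansions e + 1 ≤ y.1.expansions e} :=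
    measurableSet_le measurable_const ((measurable_expansions he).comp measurable_fst)
  have hseta : ∀ a, MeasurableSet {y : A × X | e a + 1 ≤ e y.1} := fun a =>
    measurableSet_le measurable_const (he.comp measurable_fst)
  by_cases hν : ν.Expandable C α
  · have h1 : ∀ᵐ y ∂visitKernel lam C α proposal hi hv visit ν,
        ν.expansions e + 1 ≤ y.1.expansions e :=
      ae_visitKernel hset (fun _ x => ae_of_all _ fun y => by
        rw [Node.expansions_addChild]; omega) fun h' => absurd hν h'
    have h2 : (visitKernel lam C α proposal hi hv visit ν).real
        {y | ν.expansions e + 1 ≤ y.1.expansions e} = 1 := by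
      rw [measureReal_def, (prob_compl_eq_zero_iff hset).1 h1, ENNReal.toReal_one]
    have h3 : |∫ y, f y.2 ∂visitKernel lam C α proposal hi hv visit ν| ≤ 1 := by
      have := norm_integral_le_of_norm_le_const
        (μ := visitKernel lam C α proposal hi hv visit ν) (f := fun y => f y.2)
        (ae_of_all _ fun y => hf1 y.2)
      simpa using this
    have h4 : |∫ x, f x ∂ν.sample lam v sample| ≤ 1 := by
      have hle := Node.sample_univ_le lam v hsample ν
      have : IsFiniteMeasure (ν.sample lam v sample) := ⟨hle.trans_lt ENNReal.one_lt_top⟩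
      have := norm_integral_le_of_norm_le_const
        (μ := ν.sample lam v sample) (f := f) (ae_of_all _ hf1)
      rw [one_mul] at this
      exact this.trans (ENNReal.toReal_le_of_le_ofReal zero_le_one (by simpa using hle))
    rw [h2]
    exact (abs_sub _ _).trans (by linarith)
  · have h1 := integral_visitKernel_of_not_expandable (lam := lam) (proposal := proposal)
      (hi := hi) (hv := hv) (visit := visit) hν (F := fun y => f y.2) (hf.comp measurable_snd)
      (fun y => hf1 y.2)
    have h2 := integral_visitKernel_of_not_expandable (lam := lam) (proposal := proposal)
      (hi := hi) (hv := hv) (visit := visit) hν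
      (F := {y | ν.expansions e + 1 ≤ y.1.expansions e}.indicator fun _ => (1 : ℝ))
      (measurable_const.indicator hset) (K := 1) fun y => by
        rw [abs_of_nonneg (Set.indicator_nonneg (fun _ _ => zero_le_one) _)]
        exact Set.indicator_le_self' (fun _ _ => zero_le_one) _
    have h3 : ∀ i, ∫ y, {y | ν.expansions e + 1 ≤ y.1.expansions e}.indicator (fun _ => (1 : ℝ))
        (ν.setChild i y.1, y.2) ∂visit (ν.child i) =
        (visit (ν.child i)).real {y | e (ν.child i) + 1 ≤ e y.1} := fun i => by
      rw [← integral_indicator_one (hseta _)]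
      refine integral_congr_ae (ae_of_all _ fun y => ?_)
      have := ν.expansions_setChild e i y.1
      by_cases hy : e (ν.child i) + 1 ≤ e y.1
      · have hy' : ν.expansions e + 1 ≤ (ν.setChild i y.1).expansions e := by omega
        simp only [Set.indicator_apply, Set.mem_ofPred_eq, hy, hy', if_true, Pi.one_apply]
      · have hy' : ¬ν.expansions e + 1 ≤ (ν.setChild i y.1).expansions e := by omega
        simp only [Set.indicator_apply, Set.mem_ofPred_eq, hy, hy', if_false]
    simp only [h3] at h2
    have h4 := integral_indicator_one (μ := visitKernel lam C α proposal hi hv visit ν) hset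
    have h5 : (visitKernel lam C α proposal hi hv visit ν).real
        {y | ν.expansions e + 1 ≤ y.1.expansions e} =
        ∑ i, ν.boltzmann lam v i * (visit (ν.child i)).real {y | e (ν.child i) + 1 ≤ e y.1} :=
      h4.symm.trans h2
    rw [h1, h5, Node.integral_sample lam v hsample hf hf1, ← Finset.sum_sub_distrib,
      Finset.mul_sum]
    refine (Finset.abs_sum_le_sum_abs _ _).trans (Finset.sum_le_sum fun i _ => ?_)
    rw [← mul_sub, abs_mul, abs_of_nonneg (ν.boltzmann_nonneg lam v i)]
    calc ν.boltzmann lam v i * _ ≤ ν.boltzmann lam v i * _ :=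
          mul_le_mul_of_nonneg_left (h _) (ν.boltzmann_nonneg lam v i)
      _ = _ := by ring

end Sampling

/-! ### The number of expansions -/

section Regular

variable {S A X : Type*}

/-- A node has no more children than progressive widening allows, its children satisfy `p`, and
`cnt`, the number of visits to a child, adds up to no more than the visits to the node. -/
def Node.Regular (C α : ℝ) (p : A → Prop) (cnt : A → ℕ) (ν : Node S A) : Prop :=
  (ν.numChildren : ℝ) ≤ 1 + C * (ν.visits : ℝ) ^ α ∧ ν.childSum cnt ≤ ν.visits ∧
    ∀ i, p (ν.child i)

theorem Node.regular_new {C α : ℝ} (hC : 0 < C) (p : A → Prop) (cnt : A → ℕ) (s : S) :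
    (Node.new s : Node S A).Regular C α p cnt := by
  have h : (Node.new s : Node S A).childSum cnt = 0 := Finset.sum_empty
  refine ⟨?_, by rw [h]; exact Nat.zero_le _, fun i => i.elim0⟩
  change ((0 : ℕ) : ℝ) ≤ _
  rw [Nat.cast_zero]
  positivity

theorem exists_mul_rpow_le {C α : ℝ} (hC : 0 < C) (hα : α ∈ Set.Ioo (0 : ℝ) 1) {η : ℝ}
    (hη : 0 < η) : ∃ K : ℝ, 0 ≤ K ∧ ∀ N : ℕ, C * (N : ℝ) ^ α ≤ K + η * N := by
  obtain ⟨N₀, hN₀⟩ := eventually_atTop.1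
    ((tendsto_mul_rpow_div hα C).eventually_le_const hη)
  refine ⟨C * (N₀ : ℝ) ^ α, by positivity, fun N => ?_⟩
  rcases le_total N N₀ with h | h
  · have : C * (N : ℝ) ^ α ≤ C * (N₀ : ℝ) ^ α := by
      gcongr
      exact hα.1.le
    have : 0 ≤ η * N := by positivity
    linarith
  · have h1 := hN₀ N h
    have h2 : 0 ≤ C * (N₀ : ℝ) ^ α := by positivity
    rcases Nat.eq_zero_or_pos N with rfl | hN
    · simp [hα.1.ne', h2]
    · rw [div_le_iff₀ (by exact_mod_cast hN)] at h1
      linarith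

/-- The number of expansions at a node and below it is sublinear in the number of visits, provided
that this holds for the children. -/
theorem Node.exists_expansions_le {C α : ℝ} (hC : 0 < C) (hα : α ∈ Set.Ioo (0 : ℝ) 1)
    {p : A → Prop} {cnt e : A → ℕ}
    (h : ∀ ε : ℝ, 0 < ε → ∃ K : ℝ, 0 ≤ K ∧ ∀ a, p a → (e a : ℝ) ≤ K + ε * cnt a)
    {ε : ℝ} (hε : 0 < ε) : ∃ K : ℝ, 0 ≤ K ∧ ∀ ν : Node S A, ν.Regular C α p cnt →
      (ν.expansions e : ℝ) ≤ K + ε * (ν.visits - 1 : ℕ) := by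
  obtain ⟨K₁, hK₁, h₁⟩ := h (ε / 2) (half_pos hε)
  obtain ⟨K₂, hK₂, h₂⟩ := exists_mul_rpow_le hC hα
    (show 0 < ε / 2 / (1 + K₁) by positivity)
  refine ⟨(1 + K₂) * (1 + K₁) + ε, by positivity, fun ν hν => ?_⟩
  obtain ⟨hn, hcnt, hp⟩ := hν
  have h3 : ((ν.childSum e : ℕ) : ℝ) ≤ ν.numChildren * K₁ + ε / 2 * ν.visits := by
    rw [Node.childSum, Nat.cast_sum]
    calc ∑ i, (e (ν.child i) : ℝ) ≤ ∑ i, (K₁ + ε / 2 * cnt (ν.child i)) :=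
          Finset.sum_le_sum fun i _ => h₁ _ (hp i)
      _ = ν.numChildren * K₁ + ε / 2 * (ν.childSum cnt : ℕ) := by
          rw [Finset.sum_add_distrib, ← Finset.mul_sum, Node.childSum, Nat.cast_sum]
          simp
      _ ≤ _ := by gcongr
  have h4 : (ν.numChildren : ℝ) * (1 + K₁) ≤ (1 + K₂) * (1 + K₁) + ε / 2 * ν.visits := by
    calc (ν.numChildren : ℝ) * (1 + K₁)
        ≤ (1 + (K₂ + ε / 2 / (1 + K₁) * ν.visits)) * (1 + K₁) :=
          mul_le_mul_of_nonneg_right (hn.trans (by linarith [h₂ ν.visits])) (by positivity)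
      _ = _ := by field_simp; ring
  have h5 : (ν.visits : ℝ) ≤ (ν.visits - 1 : ℕ) + 1 := by exact_mod_cast (by omega)
  rw [Node.expansions, Nat.cast_add]
  nlinarith

variable [MeasurableSpace S] [MeasurableSpace A] [MeasurableSpace X]

theorem measurableSet_regular (C α : ℝ) {p : A → Prop} (hp : MeasurableSet {a | p a})
    {cnt : A → ℕ} (hcnt : Measurable cnt) :
    MeasurableSet {ν : Node S A | ν.Regular C α p cnt} := by
  refine MeasurableSet.inter ?_ (MeasurableSet.inter
    (measurableSet_le (measurable_childSum hcnt) measurable_visits) ?_)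
  · exact measurable_index (MeasurableSet.of_discrete
      (s := {k : ℕ × ℕ | (k.2 : ℝ) ≤ 1 + C * (k.1 : ℝ) ^ α}))
  · refine measurableSet_of_node fun k => ?_
    have h : MeasurableSet (⋂ i, {q : S × (Fin k.2 → A) | p (q.2 i)}) :=
      MeasurableSet.iInter fun i => ((measurable_pi_apply i).comp measurable_snd) hp
    convert h using 1
    ext q
    simp only [Set.mem_iInter]
    rfl

variable {lam C α : ℝ} {proposal : Kernel S X} [IsMarkovKernel proposal]
  {init : X → A} {hi : Measurable init} {v : A → ℝ} {hv : Measurable v}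
  {visit : Kernel A (A × X)} [IsMarkovKernel visit]

theorem ae_regular_visitKernel (hC : 0 < C) (hα : 0 ≤ α) {p : A → Prop}
    (hp : MeasurableSet {a | p a}) {cnt : A → ℕ} (hcnt : Measurable cnt)
    (hnew : ∀ x, ∀ᵐ y ∂visit (init x), p y.1 ∧ cnt y.1 ≤ 1)
    (hold : ∀ a, p a → ∀ᵐ y ∂visit a, p y.1 ∧ cnt y.1 ≤ cnt a + 1)
    {ν : Node S A} (hν : ν.Regular C α p cnt) :
    ∀ᵐ y ∂visitKernel lam C α proposal hi hv visit ν,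
      y.1.Regular C α p cnt ∧ y.1.numChildren ≠ 0 := by
  have hset : MeasurableSet {y : Node S A × X | y.1.Regular C α p cnt ∧ y.1.numChildren ≠ 0} :=
    measurable_fst ((measurableSet_regular C α hp hcnt).inter
      (measurable_numChildren (MeasurableSet.of_discrete (s := {n | n ≠ 0}))))
  obtain ⟨hn, hcount, hchild⟩ := hν
  have hmono : C * (ν.visits : ℝ) ^ α ≤ C * ((ν.visits + 1 : ℕ) : ℝ) ^ α := by
    gcongr
    omega
  refine ae_visitKernel hset (fun hexp x => ?_) fun hexp i => ?_
  · filter_upwards [hnew x] with y hy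
    refine ⟨⟨?_, ?_, ?_⟩, Nat.succ_ne_zero _⟩
    · change ((ν.numChildren + 1 : ℕ) : ℝ) ≤ 1 + C * ((ν.visits + 1 : ℕ) : ℝ) ^ α
      have hpos : 0 ≤ C * (ν.visits : ℝ) ^ α := by positivity
      rcases hexp with h | h
      · rw [h]; push_cast at hmono ⊢; linarith
      · push_cast at hmono ⊢; linarith
    · rw [Node.childSum_addChild]
      exact add_le_add hcount hy.2
    · change ∀ i : Fin (ν.numChildren + 1), p (Fin.snoc (α := fun _ => A) ν.child y.1 i)
      intro i
      refine Fin.lastCases ?_ (fun j => ?_) i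
      · simpa using hy.1
      · simpa using hchild j
  · filter_upwards [hold _ (hchild i)] with y hy
    refine ⟨⟨?_, ?_, ?_⟩, fun h0 => hexp (Or.inl h0)⟩
    · change (ν.numChildren : ℝ) ≤ 1 + C * ((ν.visits + 1 : ℕ) : ℝ) ^ α
      linarith
    · have := ν.childSum_setChild cnt i y.1
      change (ν.setChild i y.1).childSum cnt ≤ ν.visits + 1
      omega
    · change ∀ j : Fin ν.numChildren, p (Function.update ν.child i y.1 j)
      intro j
      by_cases hj : j = i
      · subst hj; simpa using hy.1
      · rw [Function.update_of_ne hj]; exact hchild j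

end Regular

/-! ### Weak convergence from countably many sets -/

section Weak

/-- Almost sure weak convergence of random measures follows from the almost sure convergence of the
measure of each fixed set, since countably many sets determine weak convergence. -/
theorem ae_weaklyConverges {X Ω : Type*} [TopologicalSpace X] [SecondCountableTopology X]
    [MeasurableSpace X] [OpensMeasurableSpace X] [MeasurableSpace Ω] {P : Measure Ω}
    {μ : Ω → ℕ → Measure X} {ν : Measure X} [IsProbabilityMeasure ν]
    (hprob : ∀ᵐ ω ∂P, ∀ k, IsProbabilityMeasure (μ ω (k + 1)))
    (h : ∀ U, MeasurableSet U → ∀ᵐ ω ∂P,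
      Tendsto (fun k => ∫ x, U.indicator 1 x ∂μ ω k) atTop (𝓝 (∫ x, U.indicator (1 : X → ℝ) x ∂ν))) :
    ∀ᵐ ω ∂P, WeaklyConverges (μ ω) ν := by
  let b := TopologicalSpace.countableBasis X
  let 𝒮 : Set (Set X) := Set.sInter '' {F : Set (Set X) | F.Finite ∧ F ⊆ b}
  have hcount : 𝒮.Countable :=
    (Set.countable_ofPred_finite_subset (TopologicalSpace.countable_countableBasis X)).image _
  have hopen : ∀ s ∈ 𝒮, IsOpen s := by
    rintro _ ⟨F, ⟨hF, hFb⟩, rfl⟩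
    exact hF.isOpen_sInter fun t ht => TopologicalSpace.isOpen_of_mem_countableBasis (hFb ht)
  have hpi : IsPiSystem 𝒮 := by
    rintro _ ⟨F, ⟨hF, hFb⟩, rfl⟩ _ ⟨G, ⟨hG, hGb⟩, rfl⟩ _
    exact ⟨F ∪ G, ⟨hF.union hG, Set.union_subset hFb hGb⟩, Set.sInter_union F G⟩
  filter_upwards [hprob, (ae_ball_iff hcount).2 fun U hU => h U (hopen U hU).measurableSet]
    with ω hω hU f
  let μ' : ℕ → ProbabilityMeasure X := fun k => ⟨μ ω (k + 1), hω k⟩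
  have hlim : Tendsto μ' atTop (𝓝 (⟨ν, inferInstance⟩ : ProbabilityMeasure X)) := by
    refine hpi.tendsto_probabilityMeasure_of_tendsto_of_mem
      (fun s hs => (hopen s hs).measurableSet) (fun u hu x hx => ?_) fun s hs => ?_
    · obtain ⟨t, ht, hxt, htu⟩ :=
        (TopologicalSpace.isBasis_countableBasis X).exists_subset_of_mem_open hx hu
      exact ⟨t, ⟨{t}, ⟨Set.finite_singleton t, Set.singleton_subset_iff.2 ht⟩,
        Set.sInter_singleton t⟩,
        (TopologicalSpace.isOpen_of_mem_countableBasis ht).mem_nhds hxt, htu⟩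
    · have h1 := (hU s hs).comp (tendsto_add_atTop_nat 1)
      simp only [Function.comp_def, integral_indicator_one (hopen s hs).measurableSet] at h1
      exact NNReal.tendsto_coe.1 h1
  have := (ProbabilityMeasure.tendsto_iff_forall_integral_tendsto.1 hlim) f
  exact (tendsto_add_atTop_iff_nat 1).1 this

theorem integral_empirical {X : Type*} [MeasurableSpace X] (x : ℕ → X) (M : ℕ) {f : X → ℝ}
    (hf : Measurable f) : ∫ y, f y ∂empirical x M = (∑ m ∈ Finset.range M, f (x m)) / M := by
  rw [empirical, integral_smul_measure, integral_finsetSum_measure fun m _ =>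
    integrable_dirac' hf.stronglyMeasurable (by simp)]
  simp only [integral_dirac' _ _ hf.stronglyMeasurable]
  rw [ENNReal.toReal_inv, ENNReal.toReal_natCast, smul_eq_mul, div_eq_inv_mul]

theorem isProbabilityMeasure_empirical {X : Type*} [MeasurableSpace X] (x : ℕ → X) (M : ℕ) :
    IsProbabilityMeasure (empirical x (M + 1)) := by
  constructor
  simp only [empirical, Measure.smul_apply, Measure.finsetSum_apply, measure_univ,
    Finset.sum_const, Finset.card_range, smul_eq_mul, nsmul_eq_mul, mul_one]
  exact ENNReal.inv_mul_cancel (by simp) (ENNReal.natCast_ne_top _)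

end Weak

/-! ### The search tree -/

section Tree

theorem Node.sample_univ {S A X : Type*} [MeasurableSpace X] (lam : ℝ) (v : A → ℝ)
    {sample : A → Measure X} {ν : Node S A} (hn : ν.numChildren ≠ 0)
    (h : ∀ i, sample (ν.child i) Set.univ = 1) : ν.sample lam v sample Set.univ = 1 := by
  simp only [Node.sample, Measure.finsetSum_apply, Measure.smul_apply, smul_eq_mul, h, mul_one]
  rw [← ENNReal.ofReal_sum_of_nonneg fun i _ => ν.boltzmann_nonneg lam v i,
    ν.sum_boltzmann lam v hn, ENNReal.ofReal_one]

/-- One step of the recursion behind `Setup.treeAverage_eq`: if `u` is the product of the exponential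
of the value and the mean of `f` for every child, then the average of `u` over the children is this
product for the node. -/
theorem Node.childSum_div_eq {S A X : Type*} [MeasurableSpace X] {lam : ℝ} (hlam : 0 < lam)
    (v : A → ℝ) {sample : A → Measure X} (hsample : ∀ a, sample a Set.univ ≤ 1) {f : X → ℝ}
    (hf : Measurable f) {K : ℝ} (hK : ∀ x, |f x| ≤ K) {u : A → ℝ} {ν : Node S A}
    (hn : ν.numChildren ≠ 0)
    (hu : ∀ i, u (ν.child i) = Real.exp (lam * v (ν.child i)) * ∫ x, f x ∂sample (ν.child i)) :
    ν.childSum u / ν.numChildren =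
      Real.exp (lam * ν.backup lam v) * ∫ x, f x ∂ν.sample lam v sample := by
  have h : ν.childSum u = ν.childSum fun a => Real.exp (lam * v a) * ∫ x, f x ∂sample a :=
    Finset.sum_congr rfl fun i _ => hu i
  rw [h, Node.childSum_eq_mul_sum_boltzmann v hn, Node.exp_mul_backup hlam v hn,
    Node.integral_sample lam v hsample hf hK]
  ring

variable {X : Type*}

/-- The number of visits to a subtree of positive height since its creation. -/
def visitCount : ∀ t, Subtree X t → ℕ
  | 0 => fun _ => 0
  | _ + 1 => fun ν => Node.visits ν - 1

/-- The number of expansions that took place in a subtree, that is, its number of nodes except for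
the top one. -/
def totalExpansions : ∀ t, Subtree X t → ℕ
  | 0 => fun _ => 0
  | t + 1 => Node.expansions (totalExpansions t)

variable [MeasurableSpace X]

theorem measurable_visitCount : ∀ t, Measurable (visitCount t : Subtree X t → ℕ)
  | 0 => measurable_const
  | _ + 1 => (measurable_from_top (f := fun n : ℕ => n - 1)).comp measurable_visits

theorem measurable_totalExpansions : ∀ t, Measurable (totalExpansions t : Subtree X t → ℕ)
  | 0 => measurable_const
  | t + 1 => measurable_expansions (measurable_totalExpansions t)

namespace Setup

variable (D : Setup X)

/-- A subtree that results from at least one iteration: no node has more children than progressive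
widening allows, and every node above the terminal ones has a child. -/
def IsGrown : ∀ t, Subtree X t → Prop
  | 0 => fun _ => True
  | t + 1 => fun ν =>
    Node.Regular D.C D.α (IsGrown t) (visitCount t) ν ∧ Node.numChildren ν ≠ 0

theorem measurableSet_isGrown : ∀ t, MeasurableSet {a | D.IsGrown t a}
  | 0 => MeasurableSet.univ
  | t + 1 => (measurableSet_regular D.C D.α (measurableSet_isGrown t) (measurable_visitCount t)).inter
      (measurable_numChildren (MeasurableSet.of_discrete (s := {n | n ≠ 0})))

theorem ae_isGrown_visit (hC : 0 < D.C) (hα : 0 ≤ D.α) : ∀ t,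
    (∀ x, ∀ᵐ y ∂D.visit t (newSubtree t x), D.IsGrown t y.1 ∧ visitCount t y.1 ≤ 1) ∧
    (∀ a, D.IsGrown t a →
      ∀ᵐ y ∂D.visit t a, D.IsGrown t y.1 ∧ visitCount t y.1 ≤ visitCount t a + 1)
  | 0 => ⟨fun _ => ae_of_all _ fun _ => ⟨trivial, Nat.zero_le _⟩,
      fun _ _ => ae_of_all _ fun _ => ⟨trivial, Nat.zero_le _⟩⟩
  | t + 1 => by
    obtain ⟨ih₁, ih₂⟩ := ae_isGrown_visit hC hα t
    have key : ∀ ν : Subtree X (t + 1),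
        Node.Regular D.C D.α (D.IsGrown t) (visitCount t) ν →
        ∀ᵐ y ∂D.visit (t + 1) ν, D.IsGrown (t + 1) y.1 ∧
          visitCount (t + 1) y.1 = Node.visits ν := fun ν hν => by
      have h1 := ae_regular_visitKernel (lam := D.lam) (proposal := D.kernel t)
        (hi := measurable_newSubtree t) (hv := D.measurable_value t) (visit := D.visit t) hC hα
        (D.measurableSet_isGrown t) (measurable_visitCount t) ih₁ ih₂ hν
      rw [← visit_succ] at h1
      filter_upwards [h1, D.ae_visits_visit t ν] with y hy hy'
      refine ⟨hy, ?_⟩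
      change Node.visits y.1 - 1 = _
      omega
    refine ⟨fun x => ?_, fun ν hν => ?_⟩
    · filter_upwards [key _ (Node.regular_new hC _ _ x)] with y hy
      exact ⟨hy.1, hy.2.le⟩
    · filter_upwards [key ν hν.1] with y hy
      refine ⟨hy.1, ?_⟩
      change _ ≤ Node.visits ν - 1 + 1
      omega

theorem exists_totalExpansions_le (hC : 0 < D.C) (hα : D.α ∈ Set.Ioo (0 : ℝ) 1) :
    ∀ (t : ℕ) (ε : ℝ), 0 < ε → ∃ K : ℝ, 0 ≤ K ∧ ∀ a : Subtree X t, D.IsGrown t a →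
      (totalExpansions t a : ℝ) ≤ K + ε * visitCount t a
  | 0 => fun ε hε => ⟨0, le_rfl, fun a _ => by simp [totalExpansions, visitCount]⟩
  | t + 1 => fun ε hε => by
    obtain ⟨K, hK, h⟩ := Node.exists_expansions_le (S := X) hC hα
      (exists_totalExpansions_le hC hα t) hε
    exact ⟨K, hK, fun a ha => h a ha.1⟩

theorem ae_totalExpansions_le : ∀ (t : ℕ) (a : Subtree X t),
    ∀ᵐ y ∂D.visit t a, totalExpansions t a ≤ totalExpansions t y.1
  | 0 => fun _ => ae_of_all _ fun _ => Nat.zero_le _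
  | t + 1 => fun ν => by
    rw [visit_succ]
    exact ae_expansions_le (measurable_totalExpansions t) (ae_totalExpansions_le t) ν

theorem sampleSubtree_univ_le : ∀ (t : ℕ) (a : Subtree X t), D.sampleSubtree t a Set.univ ≤ 1
  | 0 => fun a => (measure_univ (μ := Measure.dirac (a : X))).le
  | t + 1 => fun ν => Node.sample_univ_le D.lam (D.value t) (sampleSubtree_univ_le t) ν

theorem sampleSubtree_univ : ∀ (t : ℕ) (a : Subtree X t), D.IsGrown t a →
    D.sampleSubtree t a Set.univ = 1
  | 0 => fun a _ => measure_univ (μ := Measure.dirac (a : X))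
  | t + 1 => fun _ hν => Node.sample_univ D.lam (D.value t) hν.2 fun i =>
      sampleSubtree_univ t _ (hν.1.2.2 i)

/-- The iterated average of `exp (lam * r) * f` factorises into the exponential of the value
estimate and the mean of `f` under sampling by selection steps: the Boltzmann weights at a node are
exactly the contributions of the children to the soft Bellman backup. -/
theorem treeAverage_eq (hlam : 0 < D.lam) {f : X → ℝ} (hf : Measurable f) {K : ℝ}
    (hK : ∀ x, |f x| ≤ K) : ∀ (t : ℕ) (a : Subtree X t), D.IsGrown t a →
      treeAverage (fun x => Real.exp (D.lam * D.reward x) * f x) t a =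
        Real.exp (D.lam * D.value t a) * ∫ x, f x ∂D.sampleSubtree t a
  | 0 => fun a _ => congrArg (fun z => Real.exp (D.lam * D.reward a) * z)
      (integral_dirac' f (a : X) hf.stronglyMeasurable).symm
  | t + 1 => fun _ hν => Node.childSum_div_eq hlam (D.value t) (D.sampleSubtree_univ_le t) hf hK
      hν.2 fun i => treeAverage_eq hlam hf hK t _ (hν.1.2.2 i)

/-- Below a node at time `t`, an iteration and sampling by selection steps differ in law by at most
the probability of an expansion. -/
theorem abs_integral_visit_sub_le {f : X → ℝ} (hf : Measurable f) (hf1 : ∀ x, |f x| ≤ 1) :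
    ∀ (t : ℕ) (a : Subtree X t), |∫ y, f y.2 ∂D.visit t a - ∫ x, f x ∂D.sampleSubtree t a| ≤
      2 * (D.visit t a).real {y | totalExpansions t a + 1 ≤ totalExpansions t y.1}
  | 0 => fun a => by
    have h1 : ∫ y, f y.2 ∂D.visit 0 a = f a := by
      rw [visit_zero_apply, integral_dirac' _ _ (by exact (hf.comp measurable_snd).stronglyMeasurable)]
    have h2 : ∫ x, f x ∂D.sampleSubtree 0 a = f a :=
      integral_dirac' _ _ hf.stronglyMeasurable
    rw [h1, h2, sub_self, abs_zero]
    positivity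
  | t + 1 => fun ν => by
    rw [visit_succ]
    exact abs_integral_visitKernel_sub_le (measurable_totalExpansions t)
      (D.sampleSubtree_univ_le t) hf hf1 (abs_integral_visit_sub_le hf hf1 t) ν

instance isProbabilityMeasure_base : IsProbabilityMeasure D.base :=
  inferInstanceAs (IsProbabilityMeasure (D.terminalKernel D.T ∘ₘ D.prior))

theorem ae_regular_run [MeasurableSingletonClass X] (hC : 0 < D.C) (hα : 0 ≤ D.α) : ∀ᵐ ω ∂D.run, ∀ k,
    (stateAt (rootTree X D.T) ω k).Regular D.C D.α (D.IsGrown D.T) (visitCount D.T) ∧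
    (stateAt (rootTree X D.T) ω k).visits = k + 1 ∧
    (stateAt (rootTree X D.T) ω (k + 1)).numChildren ≠ 0 := by
  have h1 := ae_chain_of_invariant D.iteration (rootTree X D.T)
    (measurableSet_regular D.C D.α (D.measurableSet_isGrown D.T) (measurable_visitCount D.T))
    (Node.regular_new hC _ _ ()) fun ν hν => by
      have := ae_regular_visitKernel (lam := D.lam) (proposal := Kernel.const Unit D.prior)
        (hi := measurable_newSubtree D.T) (hv := D.measurable_value D.T) (visit := D.visit D.T)
        hC hα (D.measurableSet_isGrown D.T) (measurable_visitCount D.T)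
        (D.ae_isGrown_visit hC hα D.T).1 (D.ae_isGrown_visit hC hα D.T).2 hν
      filter_upwards [this] with y hy using hy.1
  filter_upwards [h1, ae_index_state (lam := D.lam) (C := D.C) (α := D.α)
    (proposal := Kernel.const Unit D.prior) (hi := measurable_newSubtree D.T)
    (hv := D.measurable_value D.T) (visit := D.visit D.T) ()] with ω h1 h2 k
  refine ⟨h1 k, (h2 k).1, ?_⟩
  have h3 := (h2 (k + 1)).2.1
  have h4 := childCount_pos (C := D.C) (α := D.α) k
  change Node.numChildren (stateAt (Node.new ()) ω (k + 1)) ≠ 0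
  omega

theorem isProbabilityMeasure_sampleTree {τ : Tree X D.T} (hn : τ.numChildren ≠ 0)
    (hτ : τ.Regular D.C D.α (D.IsGrown D.T) (visitCount D.T)) :
    IsProbabilityMeasure (D.sampleTree τ) :=
  ⟨Node.sample_univ _ _ hn fun i => D.sampleSubtree_univ D.T _ (hτ.2.2 i)⟩

/-- Sampling by selection steps from the root gives the ratio of two averages over the children of
the root, for `exp (lam * r) * f` and for `exp (lam * r)`; their limits have the mean of `f` under
the target as their ratio. -/
theorem ae_tendsto_integral_sampleTree [MeasurableSingletonClass X] (hlam : 0 < D.lam) (hC : 0 < D.C)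
    (hα : D.α ∈ Set.Ioo (0 : ℝ) 1) {B : ℝ} (hB : ∀ x, |D.reward x| ≤ B) {f : X → ℝ}
    (hf : Measurable f) (hf1 : ∀ x, |f x| ≤ 1) :
    ∀ᵐ ω ∂D.run, Tendsto (fun k => ∫ x, f x ∂D.sampleTree (stateAt (rootTree X D.T) ω k)) atTop
      (𝓝 (∫ x, f x ∂D.target)) := by
  have hexp : Measurable fun x => Real.exp (D.lam * D.reward x) :=
    Real.measurable_exp.comp (D.measurable_reward.const_mul _)
  have hbound : ∀ g : X → ℝ, (∀ x, |g x| ≤ 1) →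
      ∀ x, |Real.exp (D.lam * D.reward x) * g x| ≤ Real.exp (D.lam * B) := fun g hg x => by
    rw [abs_mul, abs_of_pos (Real.exp_pos _)]
    refine (mul_le_of_le_one_right (Real.exp_pos _).le (hg x)).trans (Real.exp_le_exp.2 ?_)
    exact mul_le_mul_of_nonneg_left (abs_le.1 (hB x)).2 hlam.le
  have h1 : ∀ x : X, |(1 : ℝ)| ≤ 1 := fun _ => by simp
  have hint : Integrable (fun x => Real.exp (D.lam * D.reward x)) D.base :=
    Integrable.of_bound hexp.aestronglyMeasurable (Real.exp (D.lam * B)) (ae_of_all _ fun x => by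
      simpa using hbound (fun _ => 1) h1 x)
  have htarget : ∫ x, f x ∂D.target = (∫ x, Real.exp (D.lam * D.reward x) * f x ∂D.base) /
      ∫ x, Real.exp (D.lam * D.reward x) * 1 ∂D.base := by
    rw [target, integral_tilted]
    simp only [smul_eq_mul, mul_one, div_mul_eq_mul_div]
    rw [integral_div]
  have hpos : ∫ x, Real.exp (D.lam * D.reward x) * 1 ∂D.base ≠ 0 := by
    simp only [mul_one]
    exact (integral_exp_pos hint).ne'
  filter_upwards [D.ae_regular_run hC hα.1.le,
    D.ae_tendsto_rootAverage hlam hC hα hB (hexp.mul hf) (hbound f hf1),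
    D.ae_tendsto_rootAverage hlam hC hα hB (hexp.mul measurable_const) (hbound (fun _ => 1) h1)]
    with ω hreg hnum hden
  rw [htarget]
  refine (hnum.div hden hpos).congr' ?_
  filter_upwards [eventually_gt_atTop 0] with k hk
  obtain ⟨k, rfl⟩ := Nat.exists_eq_succ_of_ne_zero hk.ne'
  obtain ⟨⟨-, -, hgrown⟩, -, -⟩ := hreg (k + 1)
  have hn := (hreg k).2.2
  set ν := stateAt (rootTree X D.T) ω (k + 1)
  have ha := Node.childSum_div_eq hlam (D.value D.T) (D.sampleSubtree_univ_le D.T) hf hf1 hn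
    fun i => D.treeAverage_eq hlam hf hf1 D.T _ (hgrown i)
  have hb := Node.childSum_div_eq hlam (D.value D.T) (D.sampleSubtree_univ_le D.T)
    measurable_const h1 hn
    fun i => D.treeAverage_eq hlam measurable_const h1 D.T _ (hgrown i)
  have hc : ν.sample D.lam (D.value D.T) (D.sampleSubtree D.T) Set.univ = 1 :=
    Node.sample_univ _ _ hn fun i => D.sampleSubtree_univ D.T _ (hgrown i)
  rw [integral_const, measureReal_def, hc, ENNReal.toReal_one, one_smul, mul_one] at hb
  change ν.childSum (treeAverage (fun x => Real.exp (D.lam * D.reward x) * f x) D.T) /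
    ν.numChildren / (ν.childSum (treeAverage (fun x => Real.exp (D.lam * D.reward x) * 1) D.T) /
    ν.numChildren) = _
  rw [ha, hb, mul_div_cancel_left₀ _ (Real.exp_pos _).ne']
  rfl

/-- The terminal states reached by the iterations have the same limit: iterations that expand a node
are too rare to matter, and the other ones sample by selection steps. -/
theorem ae_tendsto_average_terminal [MeasurableSingletonClass X] (hlam : 0 < D.lam) (hC : 0 < D.C)
    (hα : D.α ∈ Set.Ioo (0 : ℝ) 1) {B : ℝ} (hB : ∀ x, |D.reward x| ≤ B) {f : X → ℝ}
    (hf : Measurable f) (hf1 : ∀ x, |f x| ≤ 1) :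
    ∀ᵐ ω ∂D.run, Tendsto (fun k : ℕ => (∑ m ∈ Finset.range k, f (ω m).2) / k) atTop
      (𝓝 (∫ x, f x ∂D.target)) := by
  set e : Tree X D.T → ℕ := Node.expansions (totalExpansions D.T) with he
  have hem : Measurable e := measurable_expansions (measurable_totalExpansions D.T)
  let E : Set (Tree X D.T × (Tree X D.T × X)) := {q | e q.1 + 1 ≤ e q.2.1}
  have hE : MeasurableSet E := measurableSet_le ((hem.comp measurable_fst).add_const 1)
    (hem.comp (measurable_fst.comp measurable_snd))
  let F : Tree X D.T → Tree X D.T × X → ℝ := fun ν y => E.indicator 1 (ν, y)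
  have hF : Measurable (Function.uncurry F) := measurable_one.indicator hE
  have hF0 : ∀ ν y, 0 ≤ F ν y := fun ν y => Set.indicator_nonneg (fun _ _ => zero_le_one) _
  have hF1 : ∀ ν y, F ν y ≤ 1 := fun ν y => Set.indicator_le_self' (fun _ _ => zero_le_one) _
  have hFint : ∀ ν, ∫ y, F ν y ∂D.iteration ν =
      (D.iteration ν).real {y | e ν + 1 ≤ e y.1} := fun ν =>
    integral_indicator_one (measurable_prodMk_left (x := ν) hE)
  have hmono : ∀ᵐ ω ∂D.run, ∀ k, e (stateAt (rootTree X D.T) ω k) ≤ e (ω k).1 :=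
    ae_chain_of_forall_ae D.iteration (rootTree X D.T) (R := fun ν y => e ν ≤ e y.1)
      (measurableSet_le (hem.comp measurable_fst) (hem.comp (measurable_fst.comp measurable_snd)))
      (ae_expansions_le (measurable_totalExpansions D.T) (D.ae_totalExpansions_le D.T))
  have hdiff : ∀ ν, |∫ y, f y.2 ∂D.iteration ν - ∫ x, f x ∂D.sampleTree ν| ≤
      2 * ∫ y, F ν y ∂D.iteration ν := fun ν => by
    rw [hFint]
    exact abs_integral_visitKernel_sub_le (measurable_totalExpansions D.T)
      (D.sampleSubtree_univ_le D.T) hf hf1 (D.abs_integral_visit_sub_le hf hf1 D.T) ν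
  filter_upwards [hmono, D.ae_regular_run hC hα.1.le,
    D.ae_tendsto_integral_sampleTree hlam hC hα hB hf hf1,
    tendsto_average_sub_condExp D.iteration (rootTree X D.T) hF (K := 1) (fun ν y => by
      rw [abs_of_nonneg (hF0 ν y)]; exact hF1 ν y),
    tendsto_average_sub_condExp D.iteration (rootTree X D.T) (F := fun _ y => f y.2)
      (hf.comp (measurable_snd.comp measurable_snd)) (K := 1) (fun _ y => hf1 y.2)]
    with ω hmono hreg hsample hllnF hlln
  set Y := stateAt (rootTree X D.T) ω with hY
  have hsumF : ∀ k : ℕ, ∑ m ∈ Finset.range k, F (Y m) (ω m) ≤ e (Y k) := fun k => by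
    induction k with
    | zero => simp
    | succ k ih =>
      rw [Finset.sum_range_succ]
      have h1 : e (Y k) ≤ e (Y (k + 1)) := hmono k
      have h1' : (e (Y k) : ℝ) ≤ e (Y (k + 1)) := by exact_mod_cast h1
      by_cases hk : (Y k, ω k) ∈ E
      · have h2 : e (Y k) + 1 ≤ e (Y (k + 1)) := hk
        have h2' : (e (Y k) : ℝ) + 1 ≤ e (Y (k + 1)) := by exact_mod_cast h2
        have h3 := hF1 (Y k) (ω k)
        linarith
      · have h3 : F (Y k) (ω k) = 0 := Set.indicator_of_notMem hk _
        linarith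
  -- Expansions become rare.
  have hFavg : Tendsto (fun k : ℕ => (∑ m ∈ Finset.range k, F (Y m) (ω m)) / k) atTop (𝓝 0) := by
    refine tendsto_order.2 ⟨fun a ha => Eventually.of_forall fun k => ha.trans_le
      (div_nonneg (Finset.sum_nonneg fun m _ => hF0 _ _) (Nat.cast_nonneg k)), fun ε hε => ?_⟩
    obtain ⟨K, hK, hle⟩ := Node.exists_expansions_le (S := Unit) hC hα
      (D.exists_totalExpansions_le hC hα D.T) (half_pos hε)
    filter_upwards [(tendsto_const_div_atTop_nhds_zero_nat K).eventually_lt_const (half_pos hε),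
      eventually_gt_atTop 0] with k hk hk0
    have hk0' : (0 : ℝ) < k := by exact_mod_cast hk0
    have h1 := hle (Y k) (hreg k).1
    rw [(hreg k).2.1, Nat.add_sub_cancel] at h1
    rw [div_lt_iff₀ hk0'] at hk ⊢
    have h2 := hsumF k
    have h3 : (e (Y k) : ℝ) ≤ K + ε / 2 * k := h1
    linarith
  have hI : Tendsto (fun k : ℕ => (∑ m ∈ Finset.range k,
      ∫ y, F (Y m) y ∂D.iteration (Y m)) / k) atTop (𝓝 0) := by
    have h3 := hFavg.sub hllnF
    rw [sub_zero] at h3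
    refine h3.congr fun k => ?_
    rw [Finset.sum_sub_distrib]
    ring
  have hces : Tendsto (fun k : ℕ => (∑ m ∈ Finset.range k, ∫ x, f x ∂D.sampleTree (Y m)) / k)
      atTop (𝓝 (∫ x, f x ∂D.target)) := by
    refine hsample.cesaro.congr fun k => ?_
    rw [div_eq_inv_mul]
  have hdev : Tendsto (fun k : ℕ => (∑ m ∈ Finset.range k,
      (∫ y, f y.2 ∂D.iteration (Y m) - ∫ x, f x ∂D.sampleTree (Y m))) / k) atTop (𝓝 0) := by
    have h4 := hI.const_mul 2
    rw [mul_zero] at h4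
    refine squeeze_zero_norm (fun k => ?_) h4
    rw [Real.norm_eq_abs, abs_div, Nat.abs_cast, ← mul_div_assoc, Finset.mul_sum]
    exact div_le_div_of_nonneg_right ((Finset.abs_sum_le_sum_abs _ _).trans
      (Finset.sum_le_sum fun m _ => hdiff _)) (Nat.cast_nonneg k)
  have hfinal := (hlln.add hdev).add hces
  rw [add_zero, zero_add] at hfinal
  refine hfinal.congr fun k => ?_
  rw [Finset.sum_sub_distrib, Finset.sum_sub_distrib]
  ring

end Setup

end Tree

end DTS

theorem proposition1 {X : Type*} [TopologicalSpace X] [PolishSpace X] [MeasurableSpace X]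
    [BorelSpace X] (D : DTS.Setup X) (hr : ∃ B : ℝ, ∀ x, |D.reward x| ≤ B) (hlam : 0 < D.lam)
    (hC : 0 < D.C) (hα : D.α ∈ Set.Ioo (0 : ℝ) 1) :
    (∀ᵐ ω ∂D.run,
      DTS.WeaklyConverges (fun M => DTS.empirical (fun m => (ω m).2) M) D.target) ∧
    (∀ᵐ ω ∂D.run,
      DTS.WeaklyConverges (fun M => D.sampleTree (ω M).1) D.target) := by
  obtain ⟨B, hB⟩ := hr
  have hexp : Integrable (fun x => Real.exp (D.lam * D.reward x)) D.base :=
    Integrable.of_bound (Real.measurable_exp.comp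
      (D.measurable_reward.const_mul _)).aestronglyMeasurable (Real.exp (D.lam * B))
      (ae_of_all _ fun x => by
        rw [Real.norm_of_nonneg (Real.exp_pos _).le]
        exact Real.exp_le_exp.2 (mul_le_mul_of_nonneg_left (abs_le.1 (hB x)).2 hlam.le))
  have hprob : IsProbabilityMeasure D.target := isProbabilityMeasure_tilted hexp
  have hind : ∀ (U : Set X) (x : X), |U.indicator (1 : X → ℝ) x| ≤ 1 := fun U x => by
    by_cases hx : x ∈ U <;> simp [hx]
  refine ⟨DTS.ae_weaklyConverges (P := D.run)
    (μ := fun (ω : ℕ → DTS.Tree X D.T × X) M => DTS.empirical (fun m => (ω m).2) M)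
    (ae_of_all _ fun ω k => DTS.isProbabilityMeasure_empirical _ k) fun U hU => ?_,
    DTS.ae_weaklyConverges (P := D.run)
    (μ := fun (ω : ℕ → DTS.Tree X D.T × X) M => D.sampleTree (ω M).1) ?_ fun U hU => ?_⟩
  · filter_upwards [D.ae_tendsto_average_terminal hlam hC hα hB
      (measurable_one.indicator hU) (hind U)] with ω hω
    have hm : Measurable (U.indicator (1 : X → ℝ)) := measurable_one.indicator hU
    simpa only [DTS.integral_empirical _ _ hm] using hω
  · filter_upwards [D.ae_regular_run hC hα.1.le] with ω hω k
    have h1 := (hω (k + 1)).2.2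
    have h2 := (hω (k + 2)).1
    rw [DTS.stateAt_succ] at h1 h2
    exact D.isProbabilityMeasure_sampleTree h1 h2
  · filter_upwards [D.ae_tendsto_integral_sampleTree hlam hC hα hB
      (measurable_one.indicator hU) (hind U)] with ω hω
    have h1 := (tendsto_add_atTop_iff_nat 1).2 hω
    simp only [DTS.stateAt_succ] at h1
    exact h1
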